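/- **Lemma.** *Conventions.* For a group $G$ let $G^{(0)}_r:=G$, let $G^{(k+1)}_r$ be the kernel of $G^{(k)}_r\to \bigl(G^{(k)}_r/[G^{(k)}_r,G^{(k)}_r]\bigr)\otimes_{\mathbb Z}\mathbb Q$ (the rational derived series), and put $G_k:=G/G^{(k)}_r$. For $R=\mathbb Q$ or $R=\mathbb Z_p$ ($p$ prime) the group ring $RG_k$ is an Ore domain; $\mathbb K(G_k)$ denotes its skew quotient field. Write $[a,b]=aba^{-1}b^{-1}$ and $a^b=b^{-1}ab$. Let $F$ be a free group of rank $2g$ with basis $x_1,\dots,x_{2g}$, let $S$ and $G$ be groups, and let $i\colon F\to S$ and $r\colon S\to G$ be homomorphisms. Groups mapping to $G$ act on $\mathbb K(G_k)$ through $G_k$ (for $R=\mathbb Q$). The map $r$ is an *algebraic $n$-solution for $i$* if $H_1(S;\mathbb Q)\neq 0$, $r$ is nontrivial, and for every $0\le k\le n-1$ the map $r_*\colon H_1(S;\mathbb K(G_k))\to H_1(G;\mathbb K(G_k))$ is nontrivial and the map $i_*\colon H_1(F;\mathbb K(G_k))\to H_1(S;\mathbb K(G_k))$ is surjective, where $\mathbb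 K(G_k)$ is the skew quotient field of $\mathbb QG_k$. The collections $\mathcal P_n$ ($n\ge 1$) of sets of $2g-1$ elements of $F$ (called tuples) are defined by $$\mathcal P_1=\bigl\{\{[x_i,x_j] : 1\le j\le 2g,\ j\ne i\} : 1\le i\le 2g\bigr\},$$ and $\{z_1,\dots,z_{2g-1}\}$ (with the $z_a$ distinct) is in $\mathcal P_{k+1}$ if and only if there is $\{w_1,\dots,w_{2g-1}\}\in\mathcal P_k$ (numbered in some order) such that for each $1\le a\le 2g-1$ either $z_a=[w_a,w_a^{x_j}]$ for some $1\le j\le 2g$ with $j\neq a$, or $z_a=[w_a,w_b]$ for some $1\le b\le 2g-1$ with $b\ne a$. Let $\partial_j\colon F\to RF$ be the Fox derivatives determined by $\partial_j(x_l)=\delta_{jl}$ and $\partial_j(ab)=\partial_j(a)+\partial_j(b)\,a^{-1}$, and let $d_j\colon F\to RG_n$ be the composition of $\partial_j$ with the ring homomorphism $RF\to RG_n$ induced by $F\xrightarrow{\,r\circ i\,}G\to G_n$. *Statement.* Let $n\ge 1$ and let $r\colon S\to G$ be an algebraic $n$-solution for $i\colon F\to S$. Then some generator $x_m$ has nontrivial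 image in $G_1$ under $F\to G\to G_1$. For every such $m$ there is a tuple $\{w_1,\dots,w_{2g-1}\}\in\mathcal P_n$ such that the $2g-1$ vectors $$\bigl(d_j(w_a)\bigr)_{1\le j\le 2g,\ j\neq m}\in (RG_n)^{2g-1},\qquad 1\le a\le 2g-1,$$ are right linearly independent over $RG_n$, for $R=\mathbb Q$ and for $R=\mathbb Z_p$ for every prime $p$ (the same tuple for all these $R$). In particular, if $x_{2g}$ has nontrivial image in $G_1$, as may be assumed after renumbering the generators, then the vectors $(d_1(w_a),\dots,d_{2g-1}(w_a))$ are right linearly independent. -/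

import Mathlib

open scoped nonZeroDivisors TensorProduct Pointwise commutatorElement

universe u

namespace AlgSol

/-! ### Group rings that are Ore domains

The facts in this section show that the group ring over a field of the quotient of a group by a
term of its rational derived series is an Ore domain. They are only needed so that the skew
quotient field of such a group ring can be written down. -/

/-- `UniqueProds` passes to extensions. -/
theorem uniqueProds_of_extension {Γ Λ M : Type*} [Group Γ] [Group Λ] [Group M]
    [UniqueProds Λ] [UniqueProds M] (f : Γ →* Λ) (h : M →* Γ) (hinj : Function.Injective h)
    (hker : f.ker ≤ h.range) : UniqueProds Γ where
  uniqueMul_of_nonempty {A B} hA hB := by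
    classical
    obtain ⟨_, ha, _, hb, hu⟩ := UniqueProds.uniqueMul_of_nonempty (hA.image f) (hB.image f)
    obtain ⟨a1, ha1, rfl⟩ := Finset.mem_image.1 ha
    obtain ⟨b1, hb1, rfl⟩ := Finset.mem_image.1 hb
    have i1 : Function.Injective fun m => a1 * h m := fun x y e => hinj (mul_left_cancel e)
    have i2 : Function.Injective fun m => h m * b1 := fun x y e => hinj (mul_right_cancel e)
    have k1 : ∀ a, f a = f a1 → ∃ m, a1 * h m = a := by
      intro a e
      obtain ⟨m, hm⟩ := hker (show a1⁻¹ * a ∈ f.ker by simp [MonoidHom.mem_ker, e])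
      exact ⟨m, by simp [hm]⟩
    have k2 : ∀ b, f b = f b1 → ∃ m, h m * b1 = b := by
      intro b e
      obtain ⟨m, hm⟩ := hker (show b * b1⁻¹ ∈ f.ker by simp [MonoidHom.mem_ker, e])
      exact ⟨m, by simp [hm]⟩
    obtain ⟨m, hm, m', hm', hmu⟩ := UniqueProds.uniqueMul_of_nonempty
      (A := (A.filter (f · = f a1)).preimage _ i1.injOn)
      (B := (B.filter (f · = f b1)).preimage _ i2.injOn)
      ⟨1, by simp [ha1]⟩ ⟨1, by simp [hb1]⟩
    rw [Finset.mem_preimage, Finset.mem_filter] at hm hm'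
    refine ⟨_, hm.1, _, hm'.1,
      UniqueMul.of_image_filter f.toMulHom hm.2 hm'.2 hu ?_⟩
    intro a b haA hbB e
    have haf := (Finset.mem_filter.1 haA).2
    have hbf := (Finset.mem_filter.1 hbB).2
    obtain ⟨x, rfl⟩ := k1 a haf
    obtain ⟨y, rfl⟩ := k2 b hbf
    have e' : x * y = m * m' := by
      apply hinj
      have : a1 * (h x * h y) * b1 = a1 * (h m * h m') * b1 := by
        simpa [mul_assoc] using e
      simpa using this
    obtain ⟨rfl, rfl⟩ := hmu (Finset.mem_preimage.2 haA) (Finset.mem_preimage.2 hbB) e'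
    exact ⟨rfl, rfl⟩

/-- Homogeneous left linear systems with more unknowns than equations have nonzero solutions. -/
def HasNullSolutions (A : Type*) [Ring A] : Prop :=
  ∀ (ι κ : Type) [Fintype ι] [Fintype κ], Fintype.card κ < Fintype.card ι →
    ∀ M : ι → κ → A, ∃ c : ι → A, c ≠ 0 ∧ ∀ j, ∑ i, c i * M i j = 0

theorem HasNullSolutions.of_comm (A : Type*) [CommRing A] [Nontrivial A] : HasNullSolutions A := by
  intro ι κ _ _ hc M
  by_contra! hcon
  refine hc.not_ge (card_le_of_injective A (Matrix.vecMulLinear (Matrix.of M)) ?_)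
  rw [injective_iff_map_eq_zero]
  intro c h
  by_contra h0
  obtain ⟨j, hj⟩ := hcon c h0
  exact hj (by simpa [Matrix.vecMul, dotProduct] using congrFun h j)

/-- A weak Folner condition for commutative groups. -/
theorem exists_folner {A : Type*} [CommGroup A] [DecidableEq A] (S : Finset A) {m n : ℕ} (hmn : m < n) :
    ∃ E : Finset A, m * (E * S).card < n * E.card := by
  classical
  by_contra! hcon
  let P : ℕ → Finset A := fun N =>
    (Fintype.piFinset fun _ : S => Finset.range N).image fun f => ∏ s : S, (s : A) ^ f s
  have hP : ∀ N, (P N).card ≤ N ^ S.card := fun N => by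
    refine Finset.card_image_le.trans ?_
    simp
  have hstep : ∀ N, P N * S ⊆ P (N + 1) := by
    intro N x hx
    obtain ⟨y, hy, s, hs, rfl⟩ := Finset.mem_mul.1 hx
    obtain ⟨f, hf, rfl⟩ := Finset.mem_image.1 hy
    refine Finset.mem_image.2 ⟨f + Pi.single ⟨s, hs⟩ 1, ?_, ?_⟩
    · simp only [Fintype.mem_piFinset, Finset.mem_range] at hf ⊢
      intro a
      have := hf a
      by_cases h : a = ⟨s, hs⟩
      · subst h; simp; omega
      · simp [h]; omega
    · simp only [Pi.add_apply, pow_add, Finset.prod_mul_distrib]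
      congr 1
      rw [Finset.prod_eq_single ⟨s, hs⟩] <;> simp +contextual
  have h1 : ∀ N, n ^ N ≤ m ^ N * (P (N + 1)).card := by
    intro N
    induction N with
    | zero =>
      have : 1 ∈ P 1 := Finset.mem_image.2 ⟨fun _ => 0, by simp, by simp⟩
      simpa using Finset.card_pos.2 ⟨_, this⟩
    | succ N ih =>
      calc n ^ (N + 1) = n ^ N * n := pow_succ ..
        _ ≤ m ^ N * (P (N + 1)).card * n := Nat.mul_le_mul_right _ ih
        _ = m ^ N * (n * (P (N + 1)).card) := by ring
        _ ≤ m ^ N * (m * (P (N + 1) * S).card) := Nat.mul_le_mul_left _ (hcon _)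
        _ ≤ m ^ N * (m * (P (N + 1 + 1)).card) := by gcongr; exact hstep _
        _ = _ := by ring
  have hn : (0 : ℝ) < n := by exact_mod_cast (Nat.zero_le m).trans_lt hmn
  have hr : |(m / n : ℝ)| < 1 := by
    rw [abs_of_nonneg (by positivity), div_lt_one hn]; exact_mod_cast hmn
  have ht := (tendsto_pow_const_mul_const_pow_of_abs_lt_one S.card hr).comp
    (Filter.tendsto_add_atTop_nat 1)
  have hlow : ∀ N : ℕ, (m / n : ℝ) ≤ ((N + 1 : ℕ) : ℝ) ^ S.card * (m / n : ℝ) ^ (N + 1) := by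
    intro N
    have h2 : (n : ℝ) ^ N ≤ m ^ N * ((N + 1 : ℕ) : ℝ) ^ S.card := by
      exact_mod_cast (h1 N).trans (Nat.mul_le_mul_left _ (hP _))
    have h3 : 1 ≤ (m / n : ℝ) ^ N * ((N + 1 : ℕ) : ℝ) ^ S.card := by
      rw [div_pow, div_mul_eq_mul_div, le_div_iff₀ (by positivity)]
      simpa using h2
    calc (m / n : ℝ) ≤ (m / n : ℝ) * ((m / n : ℝ) ^ N * ((N + 1 : ℕ) : ℝ) ^ S.card) :=
          le_mul_of_one_le_right (by positivity) h3
      _ = _ := by ring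
  have hle : (m / n : ℝ) ≤ 0 := ge_of_tendsto' ht hlow
  have hm0 : m = 0 := by
    by_contra h
    have : (0 : ℝ) < m / n := by positivity
    linarith
  have := h1 1
  simp [hm0] at this
  omega

open MonoidAlgebra in
/-- Solvability of underdetermined systems passes from `R[H]` to `R[Γ]` when `Γ / H` is abelian. -/
theorem HasNullSolutions.extension {R : Type*} [Field R] {Γ H A : Type*} [Group Γ] [Group H] [CommGroup A]
    (h : H →* Γ) (hinj : Function.Injective h) (q : Γ →* A) (hsurj : Function.Surjective q)
    (hq : h.range = q.ker) (hs : HasNullSolutions (MonoidAlgebra R H)) :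
    HasNullSolutions (MonoidAlgebra R Γ) := by
  classical
  intro ι κ _ _ hc M
  obtain ⟨t, ht⟩ := hsurj.hasRightInverse
  let hA : MonoidAlgebra R H →+* MonoidAlgebra R Γ := mapDomainRingHom R h
  have hqh : ∀ x, q (h x) = 1 := fun x => by
    have : h x ∈ q.ker := hq ▸ ⟨x, rfl⟩
    exact this
  have hm : ∀ y : Γ, ∃ m, h m = y * (t (q y))⁻¹ := by
    intro y
    have : y * (t (q y))⁻¹ ∈ h.range := by
      rw [hq, MonoidHom.mem_ker, map_mul, map_inv, ht, mul_inv_cancel]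
    exact this
  choose m hm using hm
  have hcoef : ∀ (c : MonoidAlgebra R H) (a : A) (y : Γ),
      (hA c * single (t a) 1).coeff y = if q y = a then c.coeff (m y) else 0 := by
    intro c a y
    rw [coeff_mul_single_apply, mul_one]
    split_ifs with e
    · subst e
      rw [← hm y]
      exact Finsupp.mapDomain_apply hinj _ _
    · refine Finsupp.mapDomain_of_notMem_range _ _ ?_
      rintro ⟨x, hx⟩
      apply e
      have := congrArg q hx
      rw [hqh, map_mul, map_inv, ht, eq_comm, mul_inv_eq_one] at this
      exact this
  have hdec : ∀ (b : MonoidAlgebra R Γ) (T : Finset A), (∀ x ∈ b.coeff.support, q x ∈ T) →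
      ∃ α : A → MonoidAlgebra R H, b = ∑ a ∈ T, hA (α a) * single (t a) 1 := by
    intro b T hT
    refine ⟨fun a => ofCoeff (b.coeff.comapDomain (fun x => h x * t a)
      fun x _ y _ e => hinj (mul_right_cancel e)), ?_⟩
    ext y
    rw [coeff_sum, Finsupp.finsetSum_apply]
    simp only [hcoef, Finset.sum_ite_eq]
    split_ifs with hy
    · change b.coeff y = b.coeff (h (m y) * t (q y))
      rw [hm, inv_mul_cancel_right]
    · by_contra hne
      exact hy (hT y (Finsupp.mem_support_iff.2 hne))
  have huniq : ∀ (E : Finset A) (c : A → MonoidAlgebra R H),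
      ∑ a ∈ E, hA (c a) * single (t a) 1 = 0 → ∀ a ∈ E, c a = 0 := by
    intro E c h0 a ha
    ext x
    have h1 := congrArg (fun z => z.coeff (h x * t a)) h0
    have hqa : q (h x * t a) = a := by rw [map_mul, hqh, one_mul, ht]
    have hmx : m (h x * t a) = x := hinj (by rw [hm, hqa, mul_inv_cancel_right])
    simp only [coeff_sum, Finsupp.finsetSum_apply, hcoef, hqa, hmx, Finset.sum_ite_eq,
      if_pos ha] at h1
    simpa using h1
  obtain ⟨E, hE⟩ := exists_folner
    (Finset.univ.biUnion fun i => Finset.univ.biUnion fun j => (M i j).coeff.support.image q) hc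
  set S := (Finset.univ.biUnion fun i => Finset.univ.biUnion fun j =>
    (M i j).coeff.support.image q) with hS
  have hdec' : ∀ (i : ι) (e : E) (j : κ), ∃ α : A → MonoidAlgebra R H,
      single (t e) 1 * M i j = ∑ a ∈ E * S, hA (α a) * single (t a) 1 := by
    intro i e j
    apply hdec
    intro x hx
    rw [Finsupp.mem_support_iff, coeff_single_mul_apply, one_mul] at hx
    have : q x = e * q ((t e)⁻¹ * x) := by rw [map_mul, map_inv, ht]; simp
    rw [this]
    refine Finset.mul_mem_mul e.2 ?_
    simp only [hS, Finset.mem_biUnion, Finset.mem_univ, true_and, Finset.mem_image]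
    exact ⟨i, j, _, Finsupp.mem_support_iff.2 hx, rfl⟩
  choose α hα using hdec'
  obtain ⟨eE⟩ : Nonempty (E ≃ Fin E.card) := ⟨E.equivFin⟩
  obtain ⟨eS⟩ : Nonempty ((E * S : Finset A) ≃ Fin (E * S).card) := ⟨(E * S).equivFin⟩
  obtain ⟨c, hc0, hc1⟩ := hs (ι × Fin E.card) (κ × Fin (E * S).card) (by simpa using hE)
    (fun p r => α p.1 (eE.symm p.2) r.1 (eS.symm r.2))
  refine ⟨fun i => ∑ e : E, hA (c (i, eE e)) * single (t e) 1, ?_, ?_⟩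
  · intro h0
    apply hc0
    ext1 ⟨i, k⟩
    have h1 := congrFun h0 i
    simp only [Pi.zero_apply] at h1
    have h2 := huniq E (fun a => if ha : a ∈ E then c (i, eE ⟨a, ha⟩) else 0)
      (by rw [← Finset.sum_coe_sort]; simpa using h1) (eE.symm k) (eE.symm k).2
    simpa using h2
  · intro j
    have h1 : ∀ a ∈ E * S, ∑ i, ∑ e : E, c (i, eE e) * α i e j a = 0 := by
      intro a ha
      have := hc1 (j, eS ⟨a, ha⟩)
      rw [Fintype.sum_prod_type] at this
      simp only [Equiv.symm_apply_apply] at this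
      rw [← this]
      refine Finset.sum_congr rfl fun i _ => ?_
      exact Fintype.sum_equiv eE _ _ fun e => by simp
    calc ∑ i, (∑ e : E, hA (c (i, eE e)) * single (t e) 1) * M i j
        = ∑ i, ∑ e : E, ∑ a ∈ E * S, hA (c (i, eE e) * α i e j a) * single (t a) 1 := by
          refine Finset.sum_congr rfl fun i _ => ?_
          rw [Finset.sum_mul]
          refine Finset.sum_congr rfl fun e _ => ?_
          rw [mul_assoc, hα, Finset.mul_sum]
          simp [mul_assoc]
      _ = ∑ a ∈ E * S, hA (∑ i, ∑ e : E, c (i, eE e) * α i e j a) * single (t a) 1 := by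
          simp only [map_sum, Finset.sum_mul]
          rw [Finset.sum_comm (s := E * S)]
          exact Finset.sum_congr rfl fun i _ => Finset.sum_comm
      _ = 0 := Finset.sum_eq_zero fun a ha => by rw [h1 a ha, map_zero, zero_mul]

/-- Group rings of solvable groups over fields. -/
theorem HasNullSolutions.of_isSolvable (R : Type*) [Field R] (Γ : Type*) [Group Γ] [hΓ : Group.IsSolvable Γ] :
    HasNullSolutions (MonoidAlgebra R Γ) := by
  have key : ∀ j, HasNullSolutions (MonoidAlgebra R (derivedSeries Γ j)) →
      HasNullSolutions (MonoidAlgebra R Γ) := by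
    intro j
    induction j with
    | zero =>
      intro h
      exact h.extension (derivedSeries Γ 0).subtype Subtype.val_injective
        (1 : Γ →* PUnit.{1}) (fun _ => ⟨1, rfl⟩) (by rw [Subgroup.range_subtype]; ext; simp)
    | succ j ih =>
      intro h
      apply ih
      refine h.extension (Subgroup.inclusion (derivedSeries_antitone Γ (Nat.le_succ j)))
        (Subgroup.inclusion_injective _) Abelianization.of (QuotientGroup.mk_surjective) ?_
      rw [Abelianization.ker_of]
      apply Subgroup.map_injective (derivedSeries Γ j).subtype_injective
      rw [Subgroup.map_subtype_commutator, ← derivedSeries_succ]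
      ext x
      simp only [Subgroup.mem_map, MonoidHom.mem_range, Subgroup.subtype_apply]
      constructor
      · rintro ⟨_, ⟨y, rfl⟩, rfl⟩
        exact y.2
      · intro hx
        exact ⟨_, ⟨⟨x, hx⟩, rfl⟩, rfl⟩
  obtain ⟨n, hn⟩ := hΓ.solvable
  apply key n
  have hsub : Subsingleton (derivedSeries Γ n) := by rw [hn]; infer_instance
  refine (HasNullSolutions.of_comm (MonoidAlgebra R PUnit.{1})).extension (1 : PUnit.{1} →* _)
    (fun _ _ _ => Subsingleton.elim _ _) (1 : _ →* PUnit.{1}) (fun _ => ⟨1, rfl⟩) ?_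
  ext x
  simp [Subsingleton.elim x 1]

/-- The left Ore condition for a domain in which underdetermined systems are solvable. -/
theorem HasNullSolutions.nonempty_oreSet {A : Type*} [Ring A] [NoZeroDivisors A] (hA : HasNullSolutions A) :
    Nonempty (OreLocalization.OreSet (nonZeroDivisors A)) := by
  rw [OreLocalization.nonempty_oreSet_iff]
  refine ⟨fun r₁ r₂ s h => ⟨1, by
    have := s.2.2 (r₁ - r₂) (by rw [sub_mul, h, sub_self])
    rw [sub_eq_zero.1 this]⟩, fun r s => ?_⟩
  obtain ⟨c, hc, h⟩ := hA (Fin 2) Unit (by simp) (fun i _ => ![r, s] i)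
  have h1 : c 0 * r + c 1 * s = 0 := by simpa [Fin.sum_univ_two] using h ()
  have h0 : c 0 ≠ 0 := by
    intro h0
    apply hc
    have h2 : c 1 = 0 := s.2.2 _ (by simpa [h0] using h1)
    ext i; fin_cases i <;> simp [h0, h2]
  exact ⟨-c 1, ⟨c 0, mem_nonZeroDivisors_of_ne_zero h0⟩, by
    simpa using eq_neg_of_add_eq_zero_left h1⟩

/-! ### The rational derived series -/

/-- The homomorphism `H → H_ab → ℚ ⊗ H_ab`, `h ↦ 1 ⊗ [h]`. -/
noncomputable def toRatAb (H : Type*) [Group H] :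
    H →* Multiplicative (ℚ ⊗[ℤ] Additive (Abelianization H)) where
  toFun h := Multiplicative.ofAdd (1 ⊗ₜ[ℤ] Additive.ofMul (Abelianization.of h))
  map_one' := by simp
  map_mul' a b := by simp [TensorProduct.tmul_add]

/-- The rational derived series: `G_r^(0) = G`, and `G_r^(k+1)` is the kernel of the homomorphism
from `G_r^(k)` to the tensor product of its abelianization with `ℚ`. -/
noncomputable def ratDerived (G : Type*) [Group G] : ℕ → Subgroup G
  | 0 => ⊤
  | k + 1 => (toRatAb (ratDerived G k)).ker.map (ratDerived G k).subtype

instance characteristic_ker_toRatAb (H : Type*) [Group H] : (toRatAb H).ker.Characteristic := by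
  refine Subgroup.characteristic_iff_le_comap.2 fun φ h hh => ?_
  have h1 : (1 : ℚ) ⊗ₜ[ℤ] Additive.ofMul (Abelianization.of h) = 0 :=
    congrArg Multiplicative.toAdd (MonoidHom.mem_ker.1 hh)
  have h2 := congrArg (TensorProduct.map (LinearMap.id : ℚ →ₗ[ℤ] ℚ)
    (MonoidHom.toAdditive (Abelianization.map φ.toMonoidHom)).toIntLinearMap) h1
  rw [TensorProduct.map_tmul, map_zero] at h2
  exact congrArg Multiplicative.ofAdd h2

instance normal_ratDerived (G : Type*) [Group G] : ∀ k, (ratDerived G k).Normal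
  | 0 => inferInstanceAs (⊤ : Subgroup G).Normal
  | k + 1 => by
    have := normal_ratDerived G k
    exact ConjAct.normal_of_characteristic_of_normal

theorem ratDerived_succ_le (G : Type*) [Group G] (k : ℕ) :
    ratDerived G (k + 1) ≤ ratDerived G k := by
  rintro _ ⟨y, _, rfl⟩
  exact y.2

theorem derivedSeries_le_ratDerived (G : Type*) [Group G] (k : ℕ) :
    derivedSeries G k ≤ ratDerived G k := by
  induction k with
  | zero => exact le_top
  | succ k ih =>
    rw [derivedSeries_succ]
    refine (Subgroup.commutator_mono ih ih).trans ?_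
    rw [← Subgroup.map_subtype_commutator]
    exact Subgroup.map_mono (Abelianization.commutator_subset_ker _)

/-- The quotient `G_k = G / G_r^(k)`. -/
abbrev RatQuot (G : Type*) [Group G] (k : ℕ) : Type _ := G ⧸ ratDerived G k

instance isSolvable_ratQuot (G : Type*) [Group G] (k : ℕ) : Group.IsSolvable (RatQuot G k) := by
  refine ⟨k, ?_⟩
  rw [← map_derivedSeries_eq (f := QuotientGroup.mk' (ratDerived G k))
    (QuotientGroup.mk'_surjective _), ← le_bot_iff, Subgroup.map_le_iff_le_comap,
    MonoidHom.comap_bot, QuotientGroup.ker_mk']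
  exact derivedSeries_le_ratDerived G k

instance uniqueProds_ratQuot (G : Type*) [Group G] : ∀ k, UniqueProds (RatQuot G k)
  | 0 => by
    have : Subsingleton (RatQuot G 0) := QuotientGroup.subsingleton_quotient_top
    exact ⟨fun {A B} hA hB => ⟨_, hA.choose_spec, _, hB.choose_spec, UniqueMul.of_subsingleton⟩⟩
  | k + 1 => by
    have := uniqueProds_ratQuot G k
    let φ := toRatAb (ratDerived G k)
    have hM : UniqueProds (ratDerived G k ⧸ φ.ker) :=
      UniqueProds.of_injective_mulHom (QuotientGroup.kerLift φ).toMulHom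
        (QuotientGroup.kerLift_injective φ) inferInstance
    have hmem : ∀ y : ratDerived G k, (y : G) ∈ ratDerived G (k + 1) ↔ y ∈ φ.ker := fun y =>
      Subgroup.mem_map_iff_mem (ratDerived G k).subtype_injective
    refine uniqueProds_of_extension
      (QuotientGroup.map (ratDerived G (k + 1)) (ratDerived G k) (MonoidHom.id G)
        (ratDerived_succ_le G k))
      (QuotientGroup.map φ.ker (ratDerived G (k + 1)) (ratDerived G k).subtype
        (fun y hy => (hmem y).2 hy)) ?_ ?_
    · rw [injective_iff_map_eq_one]
      intro y hy
      obtain ⟨y, rfl⟩ := QuotientGroup.mk_surjective y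
      exact (QuotientGroup.eq_one_iff _).2 ((hmem y).1 ((QuotientGroup.eq_one_iff _).1 hy))
    · intro z hz
      obtain ⟨z, rfl⟩ := QuotientGroup.mk_surjective z
      exact ⟨QuotientGroup.mk (⟨z, (QuotientGroup.eq_one_iff _).1 hz⟩ : ratDerived G k), rfl⟩

/-! ### The skew quotient field and homology -/

/-- The group ring `R G_k`. -/
abbrev GroupRing (R : Type*) [Field R] (G : Type*) [Group G] (k : ℕ) : Type _ :=
  MonoidAlgebra R (RatQuot G k)

noncomputable instance oreSet_groupRing (R : Type*) [Field R] (G : Type*) [Group G] (k : ℕ) :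
    OreLocalization.OreSet (nonZeroDivisors (GroupRing R G k)) :=
  (HasNullSolutions.of_isSolvable R (RatQuot G k)).nonempty_oreSet.some

/-- The skew quotient field `𝕂(G_k)` of `R G_k`: the Ore localization at the nonzero elements. -/
abbrev SkewField (R : Type*) [Field R] (G : Type*) [Group G] (k : ℕ) : Type _ :=
  OreLocalization (nonZeroDivisors (GroupRing R G k)) (GroupRing R G k)

/-- The multiplicative map `G → G_k ⊆ R G_k ⊆ 𝕂(G_k)`. -/
noncomputable def toSkewField (R : Type*) [Field R] (G : Type*) [Group G] (k : ℕ) :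
    G →* SkewField R G k :=
  (OreLocalization.numeratorRingHom (R := GroupRing R G k)
    (S := nonZeroDivisors (GroupRing R G k))).toMonoidHom.comp
    ((MonoidAlgebra.of R (RatQuot G k)).comp (QuotientGroup.mk' (ratDerived G k)))

/-- `𝕂(G_k)` as a left `ℤ[G]`-module: `h ∈ G` acts by left multiplication by its class in
`G_k ⊆ R G_k ⊆ 𝕂(G_k)`. (The coefficient ring is `ℤ`, lifted to the universe of `G`.) -/
noncomputable def coeffModule (R : Type) [Field R] (G : Type u) [Group G] (k : ℕ) :
    Rep.{u} (ULift.{u} ℤ) G :=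
  Rep.of (X := SkewField R G k)
    { toFun h :=
        { toFun c := toSkewField R G k h * c
          map_add' := mul_add _
          map_smul' n c := mul_smul_comm n.down (toSkewField R G k h) c }
      map_one' := by ext c; change toSkewField R G k 1 * c = c; rw [map_one, one_mul]
      map_mul' a b := by
        ext c
        change toSkewField R G k (a * b) * c = toSkewField R G k a * (toSkewField R G k b * c)
        rw [map_mul, mul_assoc] }

open CategoryTheory in
/-- Given a homomorphism `f : X → Y` and a `ℤ[Y]`-module `A`, the induced map
`H₁(X; A) → H₁(Y; A)`, where `X` acts on `A` through `f`. -/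
noncomputable abbrev mapH1 {X Y : Type u} [Group X] [Group Y] (f : X →* Y)
    (A : Rep.{u} (ULift.{u} ℤ) Y) :
    groupHomology (Rep.res f A) 1 ⟶ groupHomology A 1 :=
  groupHomology.map f (𝟙 (Rep.res f A)) 1

/-- `r : S → G` is an `R`-algebraic `n`-solution for `i : F → S`. -/
structure IsAlgebraicSolution (R : Type) [Field R] (n : ℕ) {F S G : Type u} [Group F] [Group S]
    [Group G] (i : F →* S) (r : S →* G) : Prop where
  /-- `H₁(S; R) ≠ 0`. -/
  nontrivial_H1 : Nontrivial (groupHomology (Rep.trivial (ULift.{u} ℤ) S (ULift.{u} R)) 1)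
  /-- `r` is a nontrivial homomorphism. -/
  ne_one : r ≠ 1
  /-- `r_* : H₁(S; 𝕂(G_k)) → H₁(G; 𝕂(G_k))` is nontrivial for `0 ≤ k ≤ n - 1`. -/
  map_ne_zero : ∀ k < n, mapH1 r (coeffModule R G k) ≠ 0
  /-- `i_* : H₁(F; 𝕂(G_k)) → H₁(S; 𝕂(G_k))` is surjective for `0 ≤ k ≤ n - 1`. -/
  map_surjective : ∀ k < n,
    Function.Surjective (mapH1 i (Rep.res r (coeffModule R G k)))

/-! ### Fox derivatives -/

/-- The action of `F` on `R F` in which `a` acts by right multiplication by `a⁻¹`. -/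
noncomputable def foxAction (R : Type*) [Field R] (F : Type*) [Group F] :
    F →* MulAut (Multiplicative (MonoidAlgebra R F)) where
  toFun a := AddEquiv.toMultiplicative
    { toFun c := c * MonoidAlgebra.of R F a⁻¹
      invFun c := c * MonoidAlgebra.of R F a
      left_inv c := by beta_reduce; rw [mul_assoc, ← map_mul, inv_mul_cancel, map_one, mul_one]
      right_inv c := by beta_reduce; rw [mul_assoc, ← map_mul, mul_inv_cancel, map_one, mul_one]
      map_add' b c := add_mul b c _ }
  map_one' := by
    ext1 c
    change c.toAdd * MonoidAlgebra.of R F 1⁻¹ = c.toAdd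
    rw [inv_one, map_one, mul_one]
  map_mul' a b := by
    ext1 c
    change c.toAdd * MonoidAlgebra.of R F (a * b)⁻¹
      = c.toAdd * MonoidAlgebra.of R F b⁻¹ * MonoidAlgebra.of R F a⁻¹
    rw [mul_assoc, ← map_mul, mul_inv_rev]

/-- The homomorphism `w ↦ (∂ᵢ w, w)` from `F` to the semidirect product of `R F` and `F`. -/
noncomputable def foxHom (R : Type*) [Field R] {ι F : Type*} [DecidableEq ι] [Group F]
    (x : FreeGroupBasis ι F) (i : ι) : F →* Multiplicative (MonoidAlgebra R F) ⋊[foxAction R F] F :=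
  x.lift fun j => ⟨Multiplicative.ofAdd (if i = j then 1 else 0), x j⟩

/-- The Fox derivative `∂ᵢ : F → R F` with respect to the basis `x` of the free group `F`. It is
characterized by the two theorems below: `∂ᵢ(xⱼ) = δᵢⱼ` and `∂ᵢ(ab) = ∂ᵢ(a) + ∂ᵢ(b) a⁻¹`. -/
noncomputable def foxDeriv (R : Type*) [Field R] {ι F : Type*} [DecidableEq ι] [Group F]
    (x : FreeGroupBasis ι F) (i : ι) (w : F) : MonoidAlgebra R F :=
  (foxHom R x i w).left.toAdd

theorem foxDeriv_basis (R : Type*) [Field R] {ι F : Type*} [DecidableEq ι] [Group F]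
    (x : FreeGroupBasis ι F) (i j : ι) : foxDeriv R x i (x j) = if i = j then 1 else 0 := by
  simp [foxDeriv, foxHom]

theorem foxDeriv_mul (R : Type*) [Field R] {ι F : Type*} [DecidableEq ι] [Group F]
    (x : FreeGroupBasis ι F) (i : ι) (a b : F) :
    foxDeriv R x i (a * b) = foxDeriv R x i a + foxDeriv R x i b * MonoidAlgebra.of R F a⁻¹ := by
  have hr : ∀ w, (foxHom R x i w).right = w := by
    have : SemidirectProduct.rightHom.comp (foxHom R x i) = MonoidHom.id F :=
      x.ext_hom _ _ fun j => by simp [foxHom]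
    exact fun w => DFunLike.congr_fun this w
  have h : (foxHom R x i (a * b)).left =
      (foxHom R x i a).left * foxAction R F a (foxHom R x i b).left := by
    rw [map_mul, SemidirectProduct.mul_left, hr]
  exact congrArg Multiplicative.toAdd h

/-- For `f : F → G`, the composition `dᵢ : F → R F → R G_k` of `∂ᵢ` with the ring homomorphism
induced by `F → G → G_k`. -/
noncomputable def foxD (R : Type*) [Field R] {ι F G : Type*} [DecidableEq ι] [Group F] [Group G]
    (x : FreeGroupBasis ι F) (f : F →* G) (k : ℕ) (i : ι) (w : F) : GroupRing R G k :=
  MonoidAlgebra.mapDomainRingHom R ((QuotientGroup.mk' (ratDerived G k)).comp f) (foxDeriv R x i w)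

/-- The vectors `(d_j(w_a))_{j ≠ m}` in `(R G_k)^{2g-1}`, for `1 ≤ a ≤ 2g-1`, are right linearly
independent over `R G_k`. (Right modules are modules over the opposite ring.) -/
def FoxIndependent (R : Type*) [Field R] {g : ℕ} {F G : Type*} [Group F] [Group G]
    (x : FreeGroupBasis (Fin (2 * g)) F) (f : F →* G) (k : ℕ) (m : Fin (2 * g))
    (w : Fin (2 * g - 1) → F) : Prop :=
  LinearIndependent (GroupRing R G k)ᵐᵒᵖ
    (fun (a : Fin (2 * g - 1)) (j : {j : Fin (2 * g) // j ≠ m}) => foxD R x f k j (w a))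

/-! ### The collections of tuples -/

/-- The collections `𝒫_n` of (unordered) tuples of elements of the free group `F` with basis
`x_1, …, x_{2g}`. A tuple is a set of `2g` elements for `n = 0` and of `2g - 1` elements for
`n > 0`; in the inductive step its elements may be numbered in any order. -/
def tuples {g : ℕ} {F : Type*} [Group F] (x : FreeGroupBasis (Fin (2 * g)) F) : ℕ → Set (Set F)
  | 0 => {Set.range x}
  | 1 => {W | ∃ i, W = {c | ∃ j, j ≠ i ∧ c = ⁅x i, x j⁆}}
  | k + 2 => {Z | ∃ w z : Fin (2 * g - 1) → F,
      Function.Injective w ∧ Set.range w ∈ tuples x (k + 1) ∧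
      Function.Injective z ∧ Set.range z = Z ∧
      ∀ a : Fin (2 * g - 1),
        (∃ j : Fin (2 * g), (j : ℕ) ≠ (a : ℕ) ∧ z a = ⁅w a, (x j)⁻¹ * w a * x j⁆) ∨
        (∃ b : Fin (2 * g - 1), b ≠ a ∧ z a = ⁅w a, w b⁆)}

end AlgSol

/-!
Write `f = r ∘ i` and `d_j` for the Fox derivatives in `R G_k`. The proof is an induction along the
rational derived series, run for all coefficient fields `R` at once: every choice of a tuple is
governed by which elements of `G` are trivial in `G_{k+1}`, and that is tested over `ℚ` only.

*Homology.* Let `x_m` be nontrivial in `G_1`. A class in `H₁(F; 𝕂(G_k))` is given by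
a cycle `∑ x_j ⊗ a_j` with `∑ (x_j⁻¹ - 1) a_j = 0` (`sum_crossed_eq_sum_basis`). If the
`2g - 1` vectors `d(w_a)` of a tuple in the `k`-th derived subgroup are independent, they span the
solutions of this equation over the skew field, by the fundamental formula of Fox calculus and a
dimension count (`FoxIndependent.exists_eq_sum`), so the `w_a` generate `H₁(F; 𝕂(G_k))`. As
`H₁(F) → H₁(S) → H₁(G)` is nonzero, some `w_b` is nontrivial in `G_{k+1}`
(`IsAlgebraicSolution.exists_notMem`).

*Lifting.* Independence over `R G_k` lifts to `R G_{k+1}` (`FoxIndependent.succ`). The kernel `A` of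
`G_{k+1} → G_k` is torsion-free abelian, so `R A` is a commutative domain, and `R G_{k+1}` is a free
right `R A`-module. If a matrix over `R A` has independent columns after augmentation, then some
`R`-combinations of its rows form a square matrix whose determinant has nonzero augmentation, so its
columns are independent (`eq_zero_of_augmentation`, `eq_zero_of_mapDomain`).

*New tuple.* If `v` and `w` become trivial in `G_k`, they commute in `G_{k+1}`, where
`d_j([w, v]) = d_j(w) (1 - v⁻¹) + d_j(v) (w⁻¹ - 1)`. For `j ≠ m` the vector of `[w, w^{x_m}]` is the
vector of `w` times `1 - (w^{x_m})⁻¹ + x_m w⁻¹ - x_m`, which is nonzero if `w` and `x_m` are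
nontrivial. Hence `[w_b, w_b^{x_m}]` together with `[w_a, w_b]` for `a ≠ b` is a tuple obtained from
the old one by a triangular matrix with nonzero diagonal (`FoxIndependent.commutators`).

*Numbering.* The definition of the tuples allows `[w_b, w_b^{x_m}]` only if the number of `w_b`
differs from that of `x_m`. This can be arranged by renumbering, unless `g = 1` and `x_m` is the
first generator. Then the only candidates are the iterated commutators `[x_0, x_1]`, `[w, w^{x_1}]`,
and `x_1` may be trivial in `G_k` for small `k`. As long as it is, `d_1([w, w^{x_1}]) = (w⁻¹ - 1)²`.
From the first `k` where it is not, `d_0` is nonzero too, and it suffices to follow `d_0`, since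
`(x_0⁻¹ - 1) d_0 + (x_1⁻¹ - 1) d_1 = 0` (`foxD_iteratedCommutator_ne_zero`).
-/

namespace AlgSol

/-! ### Fox calculus -/

theorem freeGroupBasis_induction {ι F : Type*} [Group F] (x : FreeGroupBasis ι F) {P : F → Prop}
    (one : P 1) (basis : ∀ j, P (x j)) (inv : ∀ a, P a → P a⁻¹)
    (mul : ∀ a b, P a → P b → P (a * b)) (a : F) : P a := by
  have h : ∀ b : FreeGroup ι, P (x.repr.symm b) := by
    intro b
    induction b using FreeGroup.induction_on with
    | C1 => simpa using one
    | of j => exact basis j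
    | inv_of j h => simpa using inv _ h
    | mul a b ha hb => simpa using mul _ _ ha hb
  simpa using h (x.repr a)

section Derivation

/-! Maps `D` from a group `F` to a ring with `D (ab) = D a + D b * τ a⁻¹`, such as the Fox
derivatives composed with a homomorphism of group rings. -/

variable {F M : Type*} [Group F] [Ring M] {τ : F →* M} {D : F → M}

theorem derivation_one (hD : ∀ a b, D (a * b) = D a + D b * τ a⁻¹) : D 1 = 0 := by
  simpa using hD 1 1

theorem derivation_inv (hD : ∀ a b, D (a * b) = D a + D b * τ a⁻¹) (a : F) :
    D a⁻¹ = -(D a * τ a) := by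
  have h := hD a⁻¹ a
  rw [inv_mul_cancel, derivation_one hD, inv_inv] at h
  exact eq_neg_of_add_eq_zero_left h.symm

theorem derivation_commutator (hD : ∀ a b, D (a * b) = D a + D b * τ a⁻¹) (a b : F) :
    D ⁅a, b⁆ = D a * (1 - τ (a * b⁻¹ * a⁻¹)) + D b * (τ a⁻¹ - τ (b * a * b⁻¹ * a⁻¹)) := by
  rw [commutatorElement_def, hD, hD, hD, derivation_inv hD, derivation_inv hD]
  simp only [mul_inv_rev, inv_inv, map_mul, mul_sub, mul_one, mul_assoc, neg_mul]
  abel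

theorem derivation_conj (hD : ∀ a b, D (a * b) = D a + D b * τ a⁻¹) (a y : F) :
    D (y⁻¹ * a * y) = D a * τ y + D y * (τ (a⁻¹ * y) - τ y) := by
  rw [hD, hD, derivation_inv hD]
  simp only [mul_inv_rev, inv_inv, mul_sub]
  abel

/-- The formula for `D [a, b]` when `a` and `b` act through commuting elements. -/
theorem derivation_commutator_of_commute (hD : ∀ a b, D (a * b) = D a + D b * τ a⁻¹) {a b : F}
    (h : τ (a * b) = τ (b * a)) :
    D ⁅a, b⁆ = D a * (1 - τ b⁻¹) + D b * (τ a⁻¹ - 1) := by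
  have h1 : τ (a * b⁻¹ * a⁻¹) = τ b⁻¹ := by
    calc τ (a * b⁻¹ * a⁻¹) = τ (b⁻¹ * (b * a) * b⁻¹ * a⁻¹) := by group
      _ = τ b⁻¹ * τ (b * a) * τ b⁻¹ * τ a⁻¹ := by simp only [map_mul]
      _ = τ (b⁻¹ * (a * b) * b⁻¹ * a⁻¹) := by rw [← h]; simp only [map_mul]
      _ = τ b⁻¹ := by congr 1; group
  have h2 : τ (b * a * b⁻¹ * a⁻¹) = 1 := by
    rw [show b * a * b⁻¹ * a⁻¹ = (b * a) * (b⁻¹ * a⁻¹) by group, map_mul, ← h, ← map_mul,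
      ← map_one τ]
    congr 1; group
  rw [derivation_commutator hD, h1, h2]

theorem derivation_commutator_conj (hD : ∀ a b, D (a * b) = D a + D b * τ a⁻¹) {a y : F}
    (h : τ (a * (y⁻¹ * a * y)) = τ ((y⁻¹ * a * y) * a)) :
    D ⁅a, y⁻¹ * a * y⁆ =
      D a * (1 - τ (y⁻¹ * a⁻¹ * y) + τ (y * a⁻¹) - τ y) +
      D y * ((τ a⁻¹ - 1) * τ y * (τ a⁻¹ - 1)) := by
  rw [derivation_commutator_of_commute hD h, derivation_conj hD,
    show (y⁻¹ * a * y)⁻¹ = y⁻¹ * a⁻¹ * y by group]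
  simp only [map_mul]
  noncomm_ring

end Derivation

/-- The multiplicative map `G → G_k ⊆ R G_k`. -/
noncomputable def toGroupRing (R : Type*) [Field R] (G : Type*) [Group G] (k : ℕ) :
    G →* GroupRing R G k :=
  (MonoidAlgebra.of R (RatQuot G k)).comp (QuotientGroup.mk' (ratDerived G k))

section Fox

variable (R : Type*) [Field R] {ι F G : Type*} [DecidableEq ι] [Group F] [Group G]
  (x : FreeGroupBasis ι F) (f : F →* G) (k : ℕ)

theorem toGroupRing_eq_iff {a b : G} :
    toGroupRing R G k a = toGroupRing R G k b ↔ (a : RatQuot G k) = b :=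
  (MonoidAlgebra.of_injective (R := R)).eq_iff

theorem toGroupRing_eq_one_iff {a : G} : toGroupRing R G k a = 1 ↔ a ∈ ratDerived G k := by
  rw [← map_one (toGroupRing R G k), toGroupRing_eq_iff, ← QuotientGroup.eq_one_iff]; rfl

theorem commutator_mem_ratDerived_succ {a b : G} (ha : a ∈ ratDerived G k)
    (hb : b ∈ ratDerived G k) : ⁅a, b⁆ ∈ ratDerived G (k + 1) := by
  have h := Subgroup.commutator_mem_commutator ha hb
  rw [← Subgroup.map_subtype_commutator] at h
  exact Subgroup.map_mono (Abelianization.commutator_subset_ker _) h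

theorem toGroupRing_mul_comm {a b : G} (ha : a ∈ ratDerived G k) (hb : b ∈ ratDerived G k) :
    toGroupRing R G (k + 1) (a * b) = toGroupRing R G (k + 1) (b * a) := by
  have h : a * b = ⁅a, b⁆ * (b * a) := by group
  rw [h, map_mul, (toGroupRing_eq_one_iff R (k + 1)).2 (commutator_mem_ratDerived_succ k ha hb),
    one_mul]

theorem foxD_basis (i j : ι) : foxD R x f k i (x j) = if i = j then 1 else 0 := by
  rw [foxD, foxDeriv_basis]
  split_ifs
  · exact map_one _
  · exact map_zero _

theorem foxD_mul (i : ι) (a b : F) :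
    foxD R x f k i (a * b) =
      foxD R x f k i a + foxD R x f k i b * (toGroupRing R G k).comp f a⁻¹ := by
  rw [foxD, foxDeriv_mul, map_add, map_mul]
  congr 2
  simp [toGroupRing]

/-- The fundamental formula of Fox calculus. -/
theorem sum_foxD [Fintype ι] (w : F) :
    ∑ j, (toGroupRing R G k (f (x j))⁻¹ - 1) * foxD R x f k j w =
      toGroupRing R G k (f w)⁻¹ - 1 := by
  have hinv := fun j => derivation_inv (foxD_mul R x f k j)
  have hmul := fun j => foxD_mul R x f k j
  induction w using freeGroupBasis_induction x with
  | one => simp [fun j => derivation_one (foxD_mul R x f k j)]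
  | basis j => simp [foxD_basis]
  | inv a ha =>
    simp only [hinv, mul_neg, ← mul_assoc, Finset.sum_neg_distrib, ← Finset.sum_mul, ha]
    simp [sub_mul, ← map_mul]
  | mul a b ha hb =>
    simp only [hmul, mul_add, ← mul_assoc, Finset.sum_add_distrib, ← Finset.sum_mul, ha, hb]
    rw [map_mul f, mul_inv_rev, map_mul, MonoidHom.comp_apply, map_inv f, sub_mul, one_mul]
    abel

/-- The projection `R G_{k+1} → R G_k`. -/
noncomputable def groupRingProj (G : Type*) [Group G] (k : ℕ) :
    GroupRing R G (k + 1) →+* GroupRing R G k :=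
  MonoidAlgebra.mapDomainRingHom R
    (QuotientGroup.map (ratDerived G (k + 1)) (ratDerived G k) (MonoidHom.id G)
        (ratDerived_succ_le G k))

theorem groupRingProj_foxD (i : ι) (w : F) :
    groupRingProj R G k (foxD R x f (k + 1) i w) = foxD R x f k i w := by
  rw [groupRingProj, foxD, foxD, ← RingHom.comp_apply, ← MonoidAlgebra.mapDomainRingHom_comp]
  rfl

end Fox

/-! ### Nonvanishing factors in group rings -/

section NonVanishing

open MonoidAlgebra

variable (R : Type*) [Field R] {Γ : Type*} [Group Γ]

theorem of_sub_one_ne_zero {a : Γ} (ha : a ≠ 1) : of R Γ a - 1 ≠ 0 := by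
  rw [sub_ne_zero, ← map_one (of R Γ)]
  exact fun h => ha (of_injective h)

/-- The factor of `D a` in `derivation_commutator_conj` is nonzero. -/
theorem conj_coefficient_ne_zero [UniqueProds Γ] {a y : Γ} (ha : a ≠ 1) (hy : y ≠ 1) :
    1 - of R Γ (y⁻¹ * a⁻¹ * y) + of R Γ (y * a⁻¹) - of R Γ y ≠ 0 := by
  classical
  -- For `y = a` the element factors; otherwise its coefficient at `1` is `1`.
  by_cases h : y = a
  · subst h
    have h1 : 1 - of R Γ (y⁻¹ * y⁻¹ * y) + of R Γ (y * y⁻¹) - of R Γ y =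
        (of R Γ y - 1) * (of R Γ y⁻¹ - 1) := by
      rw [sub_mul, mul_sub, ← map_mul]
      simp
      abel
    rw [h1]
    exact mul_ne_zero (of_sub_one_ne_zero R hy) (of_sub_one_ne_zero R (inv_ne_one.2 hy))
  · intro h0
    have h1 := congrArg (fun z => z.coeff 1) h0
    have e1 : y⁻¹ * a⁻¹ * y ≠ 1 := by
      intro e
      apply ha
      have : y * (y⁻¹ * a⁻¹ * y) * y⁻¹ = y * 1 * y⁻¹ := by rw [e]
      simpa [mul_assoc] using this
    have e2 : y * a⁻¹ ≠ 1 := fun e => h (mul_inv_eq_one.1 e)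
    simp [one_def, e1, e2, hy] at h1

/-- The factor of `D a` in `D [a, a^y]`, for a derivation `D` with `D y = 0`, is nonzero even if `a`
and `a^y` do not commute: its coefficient at `y a⁻¹` is `1`. -/
theorem conj_coefficient_ne_zero' {a y : Γ} (ha : a ≠ 1) (hy : y ≠ 1) (hay : y ≠ a) :
    1 - of R Γ (a * (y⁻¹ * a⁻¹ * y) * a⁻¹) +
      of R Γ y * (of R Γ a⁻¹ - of R Γ ((y⁻¹ * a * y) * a * (y⁻¹ * a⁻¹ * y) * a⁻¹)) ≠ 0 := by
  classical
  intro h0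
  have h1 := congrArg (fun z => z.coeff (y * a⁻¹)) h0
  have e1 : y * a⁻¹ ≠ 1 := fun e => hay (mul_inv_eq_one.1 e)
  have e2 : a * (y⁻¹ * a⁻¹ * y) * a⁻¹ ≠ y * a⁻¹ := by
    intro e
    apply hy
    have e3 := mul_right_cancel e
    have e4 : a * y⁻¹ * a⁻¹ = 1 := by
      apply mul_right_cancel (b := y)
      rw [one_mul]
      simpa only [mul_assoc] using e3
    have := congrArg (fun z => a⁻¹ * z * a) e4
    simpa [mul_assoc] using this
  have e3 : y * ((y⁻¹ * a * y) * a * (y⁻¹ * a⁻¹ * y) * a⁻¹) ≠ y * a⁻¹ := by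
    intro e
    apply ha
    have e3 : (y⁻¹ * a * y) * a * (y⁻¹ * a * y)⁻¹ = 1 := by
      rw [← mul_left_inj a⁻¹, one_mul, ← mul_right_inj y, ← e]
      group
    exact conj_eq_one_iff.1 e3
  rw [mul_sub, ← map_mul, ← map_mul] at h1
  simp [one_def, e1.symm, e2, e3] at h1

end NonVanishing

/-! ### Lifting independence along quotient maps with abelian kernel -/

/-- A matrix with finitely many columns, possibly infinitely many rows, over an augmented algebra
that is a commutative domain: its columns are independent if their augmentations are. -/
theorem eq_zero_of_augmentation {R B I J : Type*} [Field R] [CommRing B] [IsDomain B] [Algebra R B]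
    [Fintype I] (ε : B →ₐ[R] R) (V : J → I → B)
    (hV : ∀ l : I → R, (∀ j, ∑ i, ε (V j i) * l i = 0) → l = 0)
    (b : I → B) (hb : ∀ j, ∑ i, V j i * b i = 0) : b = 0 := by
  classical
  -- The augmented rows span the dual of `R^I`, so some `R`-combinations `N` of rows augment to the
  -- identity matrix; the same combinations of the rows of `V` have nonzero determinant.
  let L : J → (I → R) →ₗ[R] R := fun j => ∑ i, ε (V j i) • LinearMap.proj i
  have hL : ∀ j l, L j l = ∑ i, ε (V j i) * l i := fun j l => by simp [L]
  have hmem : ∀ i : I, (LinearMap.proj i : (I → R) →ₗ[R] R) ∈ Submodule.span R (Set.range L) := by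
    intro i
    refine FiniteDimensional.mem_span_of_iInf_ker_le_ker fun l hl => ?_
    have : l = 0 := hV l fun j => by
      rw [← hL]
      exact (Submodule.mem_iInf _).1 hl j
    simp [this]
  choose N hN using fun i => Finsupp.mem_span_range_iff_exists_finsupp.1 (hmem i)
  let W : Matrix I I B := Matrix.of fun i i' => (N i).sum fun j r => algebraMap R B r * V j i'
  have hW : ε.mapMatrix W = 1 := by
    ext i i'
    have h1 := LinearMap.congr_fun (hN i) (Pi.single i' 1)
    rw [Finsupp.sum, LinearMap.sum_apply] at h1
    simp only [LinearMap.smul_apply, hL, Pi.single_apply, mul_ite, mul_one, mul_zero,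
      Finset.sum_ite_eq', Finset.mem_univ, if_true, smul_eq_mul, LinearMap.proj_apply] at h1
    simp only [AlgHom.mapMatrix_apply, Matrix.map_apply, W, Matrix.of_apply, Finsupp.sum, map_sum,
      map_mul, AlgHom.commutes, Matrix.one_apply]
    exact h1
  have hdet : W.det ≠ 0 := by
    intro h0
    have := congrArg ε h0
    rw [AlgHom.map_det, hW] at this
    simp at this
  refine Matrix.eq_zero_of_mulVec_eq_zero hdet ?_
  ext i
  simp only [Matrix.mulVec, dotProduct, W, Matrix.of_apply, Finsupp.sum, Finset.sum_mul, mul_assoc]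
  rw [Finset.sum_comm]
  simp [← Finset.mul_sum, hb]

section Coset

open MonoidAlgebra

variable {R Γ A : Type*} [Field R] [Group Γ] [CommGroup A]

/-- For an injective homomorphism `h : A → Γ` and `s ∈ Γ`, the `R A`-component of an element of
`R Γ` at the coset `s h(A)`. -/
noncomputable def cosetCoeff (h : A →* Γ) (hinj : Function.Injective h) (s : Γ) :
    MonoidAlgebra R Γ →+ MonoidAlgebra R A where
  toFun c := ofCoeff (c.coeff.comapDomain (fun a => s * h a)
    fun _ _ _ _ e => hinj (mul_left_cancel e))
  map_zero' := by ext; simp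
  map_add' _ _ := by ext; rfl

variable (h : A →* Γ) (hinj : Function.Injective h)

theorem coeff_cosetCoeff (s : Γ) (c : MonoidAlgebra R Γ) (a : A) :
    (cosetCoeff h hinj s c).coeff a = c.coeff (s * h a) := rfl

/-- The components at the cosets are right `R A`-linear. -/
theorem cosetCoeff_mul (s : Γ) (c : MonoidAlgebra R Γ) (b : MonoidAlgebra R A) :
    cosetCoeff h hinj s (c * mapDomainRingHom R h b) = cosetCoeff h hinj s c * b := by
  induction b using MonoidAlgebra.induction_linear with
  | zero => simp
  | add b b' hb hb' => simp only [map_add, mul_add, hb, hb']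
  | single a r =>
    ext a'
    simp [coeff_cosetCoeff, coeff_mul_single_apply, mul_assoc]

/-- The augmentation of a component at a coset is a coefficient of the image in `R Q`. -/
theorem lift_cosetCoeff {Q : Type*} [Group Q] (q : Γ →* Q) (hq : h.range = q.ker) (s : Γ)
    (c : MonoidAlgebra R Γ) :
    MonoidAlgebra.lift R R A 1 (cosetCoeff h hinj s c) =
      (mapDomainRingHom R q c).coeff (q s) := by
  classical
  induction c using MonoidAlgebra.induction_linear with
  | zero => simp
  | add b b' hb hb' => simp only [map_add, hb, hb', coeff_add, Finsupp.add_apply]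
  | single y r =>
    by_cases hy : q y = q s
    · obtain ⟨a, ha⟩ : s⁻¹ * y ∈ h.range := by rw [hq, MonoidHom.mem_ker]; simp [hy]
      have : cosetCoeff h hinj s (single y r) = single a r := by
        ext a'
        have : y = s * h a' ↔ a = a' := by
          rw [← inv_mul_eq_iff_eq_mul, ← ha, hinj.eq_iff]
        simp [coeff_cosetCoeff, Finsupp.single_apply, this]
      simp [this, hy]
    · have : cosetCoeff h hinj s (single y r) = 0 := by
        ext a'
        have hqa : q (h a') = 1 := by
          have : h a' ∈ q.ker := hq ▸ ⟨a', rfl⟩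
          exact this
        have : y ≠ s * h a' := by
          rintro rfl
          exact hy (by rw [map_mul, hqa, mul_one])
        simp [coeff_cosetCoeff, this]
      simp [this, hy]

/-- An element of `R Γ` is the sum of its components at the cosets `t(u) h(A)`. -/
theorem sum_cosetCoeff {Q : Type*} [Group Q] (q : Γ →* Q) (hq : h.range = q.ker) {t : Q → Γ}
    (ht : Function.RightInverse t q) (U : Finset Q) (c : MonoidAlgebra R Γ)
    (hU : ∀ y ∈ c.coeff.support, q y ∈ U) :
    ∑ u ∈ U, single (t u) 1 * mapDomainRingHom R h (cosetCoeff h hinj (t u) c) = c := by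
  classical
  have hqh : ∀ x, q (h x) = 1 := fun x => by
    have : h x ∈ q.ker := hq ▸ ⟨x, rfl⟩
    exact this
  have key : ∀ (y : Γ) (u : Q), (single (t u) 1 *
      mapDomainRingHom R h (cosetCoeff h hinj (t u) c)).coeff y =
        if u = q y then c.coeff y else 0 := by
    intro y u
    rw [coeff_single_mul_apply, one_mul]
    split_ifs with e
    · subst e
      obtain ⟨a, ha⟩ : (t (q y))⁻¹ * y ∈ h.range := by
        rw [hq, MonoidHom.mem_ker, map_mul, map_inv, ht, inv_mul_cancel]
      rw [← ha]
      refine (Finsupp.mapDomain_apply hinj _ _).trans ?_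
      rw [coeff_cosetCoeff, ha, mul_inv_cancel_left]
    · refine Finsupp.mapDomain_of_notMem_range _ _ ?_
      rintro ⟨a, ha⟩
      have := congrArg q ha
      rw [hqh, map_mul, map_inv, ht, eq_comm, inv_mul_eq_one] at this
      exact e this
  ext y
  rw [coeff_sum, Finsupp.finsetSum_apply]
  simp only [key, Finset.sum_ite_eq']
  split_ifs with hy
  · rfl
  · by_contra hne
    exact hy (hU y (Finsupp.mem_support_iff.2 (Ne.symm hne)))

/-- If the columns of a matrix over `R Γ` become right independent over `R Q`, where the kernel of
`Γ → Q` is abelian and torsion-free, then they are right independent. -/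
theorem eq_zero_of_mapDomain {Q I J : Type*} [Group Q] [Fintype I] [UniqueProds A] (q : Γ →* Q)
    (hsurj : Function.Surjective q) (hq : h.range = q.ker) (hinj : Function.Injective h)
    (M : J → I → MonoidAlgebra R Γ)
    (hM : ∀ c : I → MonoidAlgebra R Q,
      (∀ j, ∑ i, mapDomainRingHom R q (M j i) * c i = 0) → c = 0)
    (c : I → MonoidAlgebra R Γ) (hc : ∀ j, ∑ i, M j i * c i = 0) : c = 0 := by
  classical
  obtain ⟨t, ht⟩ := hsurj.hasRightInverse
  let U : Finset Q := Finset.univ.biUnion fun i => (c i).coeff.support.image q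
  have hU : ∀ i, ∀ y ∈ (c i).coeff.support, q y ∈ U := fun i y hy =>
    Finset.mem_biUnion.2 ⟨i, Finset.mem_univ _, Finset.mem_image_of_mem q hy⟩
  have hsum : ∀ i, ∑ u : U, single (t u) 1 *
      mapDomainRingHom R h (cosetCoeff h hinj (t u) (c i)) = c i := fun i => by
    rw [Finset.sum_coe_sort U fun u => single (t u) 1 *
      mapDomainRingHom R h (cosetCoeff h hinj (t u) (c i))]
    exact sum_cosetCoeff h hinj q hq ht U (c i) (hU i)
  have : IsDomain (MonoidAlgebra R A) := { exists_pair_ne := exists_pair_ne _ }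
  have hb := eq_zero_of_augmentation (I := I × U) (J := J × Q) (MonoidAlgebra.lift R R A 1)
    (fun p r => cosetCoeff h hinj (t p.2) (M p.1 r.1 * single (t r.2) 1)) ?_
    (fun r => cosetCoeff h hinj (t r.2) (c r.1)) ?_
  · ext1 i
    rw [← hsum i]
    refine Finset.sum_eq_zero fun u _ => ?_
    have : cosetCoeff h hinj (t u) (c i) = 0 := congrFun hb (i, u)
    rw [this, map_zero, mul_zero]
  · intro l hl
    have h1 := hM (fun i => ∑ u : U, single (u : Q) (l (i, u))) fun j => by
      ext s
      have h2 := hl (j, s)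
      rw [Fintype.sum_prod_type] at h2
      simp only [lift_cosetCoeff h hinj q hq, ht s] at h2
      rw [coeff_zero, Finsupp.zero_apply, ← h2, coeff_sum, Finsupp.finsetSum_apply]
      refine Finset.sum_congr rfl fun i _ => ?_
      rw [Finset.mul_sum, coeff_sum, Finsupp.finsetSum_apply]
      refine Finset.sum_congr rfl fun u _ => ?_
      rw [map_mul, mapDomainRingHom_apply (x := single _ _), mapDomain_single, ht]
      simp [coeff_mul_single_apply]
    ext ⟨i, u⟩
    have h2 := congrArg (fun z => z.coeff (u : Q)) (congrFun h1 i)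
    simpa [coeff_sum, Finsupp.finsetSum_apply, Finsupp.single_apply] using h2
  · rintro ⟨j, s⟩
    simp only [← cosetCoeff_mul]
    rw [← map_sum, Fintype.sum_prod_type]
    simp only [mul_assoc, ← Finset.mul_sum, hsum, hc, map_zero]

end Coset

/-! ### Independence of Fox derivatives over the group rings -/

/-- Independence over the opposite ring, spelled out with coefficients on the right. -/
theorem foxIndependent_iff {R : Type*} [Field R] {g : ℕ} {F G : Type*} [Group F] [Group G]
    {x : FreeGroupBasis (Fin (2 * g)) F} {f : F →* G} {k : ℕ} {m : Fin (2 * g)}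
    {w : Fin (2 * g - 1) → F} :
    FoxIndependent R x f k m w ↔ ∀ c : Fin (2 * g - 1) → GroupRing R G k,
      (∀ j, j ≠ m → ∑ a, foxD R x f k j (w a) * c a = 0) → c = 0 := by
  rw [FoxIndependent, Fintype.linearIndependent_iff]
  constructor
  · intro h c hc
    ext1 a
    have := h (fun a => MulOpposite.op (c a)) (by
      ext1 j
      simpa using hc j j.2) a
    simpa using this
  · intro h c hc a
    have := h (fun a => (c a).unop) fun j hj => by
      simpa using congrFun hc ⟨j, hj⟩
    simpa using congrFun this a

theorem FoxIndependent.injective {R : Type*} [Field R] {g : ℕ} {F G : Type*} [Group F] [Group G]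
    {x : FreeGroupBasis (Fin (2 * g)) F} {f : F →* G} {k : ℕ} {m : Fin (2 * g)}
    {w : Fin (2 * g - 1) → F} (h : FoxIndependent R x f k m w) : Function.Injective w := by
  intro a b hab
  exact LinearIndependent.injective h (by simp only [hab])

/-- Independence over `R G_k` implies independence over `R G_{k+1}`. -/
theorem foxD_independent_succ {R : Type*} [Field R] {ι I J F G : Type*} [DecidableEq ι] [Fintype I]
    [Group F] [Group G] (x : FreeGroupBasis ι F) (f : F →* G) (k : ℕ) (e : J → ι) (w : I → F)
    (hw : ∀ c : I → GroupRing R G k, (∀ j, ∑ a, foxD R x f k (e j) (w a) * c a = 0) → c = 0)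
    (c : I → GroupRing R G (k + 1)) (hc : ∀ j, ∑ a, foxD R x f (k + 1) (e j) (w a) * c a = 0) :
    c = 0 := by
  let q : RatQuot G (k + 1) →* RatQuot G k :=
    QuotientGroup.map (ratDerived G (k + 1)) (ratDerived G k) (MonoidHom.id G)
      (ratDerived_succ_le G k)
  have hcomm : ∀ a b : q.ker, a * b = b * a := by
    rintro ⟨a, ha⟩ ⟨b, hb⟩
    obtain ⟨a, rfl⟩ := QuotientGroup.mk_surjective a
    obtain ⟨b, rfl⟩ := QuotientGroup.mk_surjective b
    have ha' : a ∈ ratDerived G k := (QuotientGroup.eq_one_iff a).1 ha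
    have hb' : b ∈ ratDerived G k := (QuotientGroup.eq_one_iff b).1 hb
    ext1
    exact (toGroupRing_eq_iff ℚ (k + 1)).1 (toGroupRing_mul_comm ℚ k ha' hb')
  let _ : CommGroup q.ker := { (inferInstance : Group q.ker) with mul_comm := hcomm }
  have : UniqueProds q.ker := UniqueProds.of_injective_mulHom q.ker.subtype.toMulHom
    q.ker.subtype_injective inferInstance
  have hsurj : Function.Surjective q := by
    intro y
    obtain ⟨y, rfl⟩ := QuotientGroup.mk_surjective y
    exact ⟨(y : RatQuot G (k + 1)), rfl⟩
  refine eq_zero_of_mapDomain q.ker.subtype q hsurj (Subgroup.range_subtype _)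
    q.ker.subtype_injective (fun j a => foxD R x f (k + 1) (e j) (w a)) ?_ c hc
  intro d hd
  refine hw d fun j => ?_
  rw [← hd j]
  refine Finset.sum_congr rfl fun a _ => ?_
  rw [← groupRingProj_foxD]
  rfl

theorem foxD_ne_zero_succ {R : Type*} [Field R] {ι F G : Type*} [DecidableEq ι]
    [Group F] [Group G] (x : FreeGroupBasis ι F) (f : F →* G) (k : ℕ) (j : ι) (w : F)
    (hw : foxD R x f k j w ≠ 0) : foxD R x f (k + 1) j w ≠ 0 := fun h =>
  hw (by rw [← groupRingProj_foxD, h, map_zero])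

theorem FoxIndependent.succ {R : Type*} [Field R] {g : ℕ} {F G : Type*} [Group F] [Group G]
    {x : FreeGroupBasis (Fin (2 * g)) F} {f : F →* G} {k : ℕ} {m : Fin (2 * g)}
    {w : Fin (2 * g - 1) → F} (h : FoxIndependent R x f k m w) :
    FoxIndependent R x f (k + 1) m w := by
  rw [foxIndependent_iff] at h ⊢
  intro c hc
  exact foxD_independent_succ x f k (fun j : {j // j ≠ m} => (j : Fin (2 * g))) w
    (fun c hc => h c fun j hj => hc ⟨j, hj⟩) c fun j => hc j j.2

/-! ### Spanning over the skew quotient field -/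

section Ore

open MonoidAlgebra

/-- The inversion of a group, extended to an anti-automorphism of the group ring. -/
noncomputable def invHom (R Γ : Type*) [Field R] [Group Γ] :
    MonoidAlgebra R Γ →+* (MonoidAlgebra R Γ)ᵐᵒᵖ :=
  (MonoidAlgebra.lift R (MonoidAlgebra R Γ)ᵐᵒᵖ Γ
    { toFun a := MulOpposite.op (of R Γ a⁻¹)
      map_one' := by rw [inv_one, map_one, MulOpposite.op_one]
      map_mul' a b := by rw [mul_inv_rev, map_mul, MulOpposite.op_mul] }).toRingHom

/-- `invHom` is an involution. -/
theorem invHom_invHom {R Γ : Type*} [Field R] [Group Γ] (c : MonoidAlgebra R Γ) :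
    (invHom R Γ (invHom R Γ c).unop).unop = c := by
  induction c using MonoidAlgebra.induction_linear with
  | zero => simp
  | add a b ha hb => simp [ha, hb]
  | single a r => simp [invHom]

/-- Homogeneous right linear systems with more unknowns than equations have nonzero solutions over
the group ring of a solvable group. -/
theorem exists_right_null_solution (R : Type*) [Field R] (Γ : Type*) [Group Γ] [Group.IsSolvable Γ]
    {ι κ : Type} [Fintype ι] [Fintype κ] (hcard : Fintype.card κ < Fintype.card ι)
    (M : κ → ι → MonoidAlgebra R Γ) :
    ∃ c : ι → MonoidAlgebra R Γ, c ≠ 0 ∧ ∀ j, ∑ i, M j i * c i = 0 := by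
  obtain ⟨d, hd0, hd⟩ := HasNullSolutions.of_isSolvable R Γ ι κ hcard
    fun i j => (invHom R Γ (M j i)).unop
  refine ⟨fun i => (invHom R Γ (d i)).unop, fun h => hd0 ?_, fun j => ?_⟩
  · ext1 i
    rw [← invHom_invHom (d i), congrFun h i]
    simp
  · have := congrArg (fun z => (invHom R Γ z).unop) (hd j)
    simpa [invHom_invHom] using this

/-- Finitely many elements of an Ore localization have a common left denominator. -/
theorem exists_common_denominator {A : Type*} [Ring A] {S : Submonoid A} [OreLocalization.OreSet S]
    {ι : Type*} [Fintype ι] (a : ι → OreLocalization S A) :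
    ∃ (s : S) (y : ι → A), ∀ i,
      OreLocalization.numeratorHom (s : A) * a i = OreLocalization.numeratorHom (y i) := by
  classical
  have key : ∀ T : Finset ι, ∃ (s : S) (y : ι → A), ∀ i ∈ T,
      OreLocalization.numeratorHom (s : A) * a i = OreLocalization.numeratorHom (y i) := by
    intro T
    induction T using Finset.induction_on with
    | empty => exact ⟨1, 0, by simp⟩
    | insert l T hl ih =>
      obtain ⟨s, y, hy⟩ := ih
      obtain ⟨b, s', hb⟩ : ∃ (b : A) (s' : S),
          OreLocalization.numeratorHom (s' : A) * a l = OreLocalization.numeratorHom b := by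
        induction a l using OreLocalization.ind with
        | _ b s' =>
          refine ⟨b, s', ?_⟩
          rw [OreLocalization.numeratorHom_apply, OreLocalization.numeratorHom_apply,
            OreLocalization.mul_cancel]
      obtain ⟨v, t, e⟩ := OreLocalization.oreCondition (s : A) s'
      refine ⟨t * s, fun i => if i = l then v * b else t * y i, fun i hi => ?_⟩
      beta_reduce
      by_cases hil : i = l
      · subst hil
        rw [if_pos rfl, map_mul, ← hb, Submonoid.coe_mul, e, map_mul, mul_assoc]
      · rw [if_neg hil, map_mul, ← hy i ((Finset.mem_insert.1 hi).resolve_left hil),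
          Submonoid.coe_mul, map_mul, mul_assoc]
  obtain ⟨s, y, h⟩ := key Finset.univ
  exact ⟨s, y, fun i => h i (Finset.mem_univ i)⟩

end Ore

/-- The inclusion `R G_k ⊆ 𝕂(G_k)`. -/
noncomputable def toFrac (R : Type*) [Field R] (G : Type*) [Group G] (k : ℕ) :
    GroupRing R G k →+* SkewField R G k :=
  OreLocalization.numeratorRingHom (R := GroupRing R G k) (S := nonZeroDivisors (GroupRing R G k))

theorem toFrac_injective (R : Type*) [Field R] (G : Type*) [Group G] (k : ℕ) :
    Function.Injective (toFrac R G k) :=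
  OreLocalization.numeratorHom_inj (inf_le_left)

/-- If the vectors `d(w_a)` are independent, then they span the kernel of the fundamental functional
`(a_j) ↦ ∑ (x_j⁻¹ - 1) a_j` over the skew field. -/
theorem FoxIndependent.exists_eq_sum {R : Type*} [Field R] {g : ℕ} {F G : Type*} [Group F] [Group G]
    {x : FreeGroupBasis (Fin (2 * g)) F} {f : F →* G} {k : ℕ} {m : Fin (2 * g)}
    {w : Fin (2 * g - 1) → F} (h : FoxIndependent R x f k m w) (hm : f (x m) ∉ ratDerived G k)
    (hw : ∀ b, f (w b) ∈ ratDerived G k) (a : Fin (2 * g) → SkewField R G k)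
    (ha : ∑ j, (toSkewField R G k (f (x j))⁻¹ - 1) * a j = 0) :
    ∃ c : Fin (2 * g - 1) → SkewField R G k,
      ∀ j, a j = ∑ b, toFrac R G k (foxD R x f k j (w b)) * c b := by
  -- A right linear relation between `s a` and the vectors `s d(w_b)`, with `2g` unknowns and
  -- `2g - 1` equations, determines the coordinates of `a` other than the `m`-th; the last one
  -- follows from the fundamental formula.
  rw [foxIndependent_iff] at h
  obtain ⟨s, y, hy⟩ := exists_common_denominator a
  change ∀ i, toFrac R G k s * a i = toFrac R G k (y i) at hy
  have hs0 : (s : GroupRing R G k) ≠ 0 := nonZeroDivisors.coe_ne_zero s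
  have hs : toFrac R G k s ≠ 0 := by
    rw [← map_zero (toFrac R G k)]
    exact (toFrac_injective R G k).ne hs0
  obtain ⟨c, hc0, hc⟩ := exists_right_null_solution R (RatQuot G k)
    (ι := Option (Fin (2 * g - 1))) (κ := {j : Fin (2 * g) // j ≠ m})
    (by have := m.2; simp)
    (fun j b => b.elim (-y j) fun b => s * foxD R x f k j (w b))
  simp only [Fintype.sum_option, Option.elim, mul_assoc, ← Finset.mul_sum] at hc
  have hn : c none ≠ 0 := by
    intro hn
    apply hc0
    have := h (fun b => c (some b)) fun j hj => by
      have h1 := hc ⟨j, hj⟩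
      rw [hn, mul_zero, zero_add] at h1
      exact (mul_eq_zero.1 h1).resolve_left hs0
    ext1 b
    cases b with
    | none => exact hn
    | some b => exact congrFun this b
  have hn' : toFrac R G k (c none) ≠ 0 := by
    rw [← map_zero (toFrac R G k)]
    exact (toFrac_injective R G k).ne hn
  have hne : ∀ j, j ≠ m → a j = ∑ b, toFrac R G k (foxD R x f k j (w b)) *
      (toFrac R G k (c (some b)) * (toFrac R G k (c none))⁻¹) := by
    intro j hj
    apply mul_left_cancel₀ hs
    rw [hy]
    apply mul_right_cancel₀ hn'
    simp only [← mul_assoc, ← Finset.sum_mul]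
    rw [mul_assoc _ _ (toFrac R G k (c none)), inv_mul_cancel₀ hn', mul_one]
    have h1 := congrArg (toFrac R G k) (hc ⟨j, hj⟩)
    rw [map_add, neg_mul, map_neg, map_zero, neg_add_eq_zero] at h1
    simpa [map_sum, map_mul] using h1
  refine ⟨fun b => toFrac R G k (c (some b)) * (toFrac R G k (c none))⁻¹, fun j => ?_⟩
  by_cases hj : j = m
  · subst hj
    have hfund : ∀ b, ∑ i, (toSkewField R G k (f (x i))⁻¹ - 1) *
        toFrac R G k (foxD R x f k i (w b)) = 0 := fun b => by
      have h1 := congrArg (toFrac R G k) (sum_foxD R x f k (w b))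
      rw [(toGroupRing_eq_one_iff R k).2 (inv_mem (hw b)), sub_self, map_zero, map_sum] at h1
      simp only [map_mul, map_sub, map_one] at h1
      exact h1
    have hj0 : toSkewField R G k (f (x j))⁻¹ - 1 ≠ 0 := by
      rw [sub_ne_zero]
      intro h1
      apply hm
      rw [← inv_mem_iff, ← toGroupRing_eq_one_iff R k]
      apply toFrac_injective R G k
      rw [map_one]
      exact h1
    apply mul_left_cancel₀ hj0
    have h2 : ∑ i, (toSkewField R G k (f (x i))⁻¹ - 1) *
        (a i - ∑ b, toFrac R G k (foxD R x f k i (w b)) *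
          (toFrac R G k (c (some b)) * (toFrac R G k (c none))⁻¹)) = 0 := by
      simp only [mul_sub, Finset.sum_sub_distrib, ha, Finset.mul_sum, zero_sub, neg_eq_zero]
      rw [Finset.sum_comm]
      refine Finset.sum_eq_zero fun b _ => ?_
      simp only [← mul_assoc, ← Finset.sum_mul, hfund, zero_mul]
    rw [Finset.sum_eq_single j] at h2
    · rw [mul_sub, sub_eq_zero] at h2
      exact h2
    · intro i _ hi
      rw [← hne i hi, sub_self, mul_zero]
    · simp
  · exact hne j hj

/-! ### First homology and Fox derivatives -/

/-- The kernel of `M → ℚ ⊗ M` is torsion. -/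
theorem exists_smul_eq_zero_of_one_tmul {M : Type*} [AddCommGroup M] {y : M}
    (hy : (1 : ℚ) ⊗ₜ[ℤ] y = 0) : ∃ n : ℤ, n ≠ 0 ∧ n • y = 0 := by
  have h : IsLocalizedModule (nonZeroDivisors ℤ) (TensorProduct.mk ℤ ℚ M 1) :=
    (isLocalizedModule_iff_isBaseChange (nonZeroDivisors ℤ) ℚ _).2
      (TensorProduct.isBaseChange ℤ M ℚ)
  obtain ⟨n, hn⟩ := (IsLocalizedModule.eq_zero_iff (nonZeroDivisors ℤ)
    (TensorProduct.mk ℤ ℚ M 1)).1 hy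
  exact ⟨n, nonZeroDivisors.coe_ne_zero n, hn⟩

section Theta

variable {K Q G : Type*} [DivisionRing K] [AddCommGroup Q] [Group G] {τ : G →* K}
  {θ : G → K →+ Q}

/-- A crossed homomorphism with coefficients in a skew field of characteristic zero vanishes on
`G_r^(k+1)` if `G_r^(k)` acts trivially: it is a homomorphism on `G_r^(k)`, and its values can be
divided by integers. -/
theorem crossed_eq_zero [CharZero K]
    (hθ : ∀ a b c, θ (a * b) c = θ a c + θ b (τ a⁻¹ * c)) (k : ℕ)
    (hτ : ∀ a ∈ ratDerived G k, τ a = 1) {a : G} (ha : a ∈ ratDerived G (k + 1)) (c : K) :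
    θ a c = 0 := by
  obtain ⟨a, ha, rfl⟩ := ha
  let T : K → ratDerived G k →* Multiplicative Q := fun c =>
    MonoidHom.mk' (fun h => Multiplicative.ofAdd (θ h c)) fun a b => by
      have h := hθ a b c
      rw [hτ _ (inv_mem a.2), one_mul] at h
      exact congrArg Multiplicative.ofAdd h
  obtain ⟨n, hn, hy⟩ := exists_smul_eq_zero_of_one_tmul
    (congrArg Multiplicative.toAdd (MonoidHom.mem_ker.1 ha))
  have hn' : (n : K) ≠ 0 := by exact_mod_cast hn
  have h1 := congrArg (MonoidHom.toAdditiveLeft (Abelianization.lift (T ((n : K)⁻¹ * c)))) hy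
  rw [map_zsmul, map_zero] at h1
  have h2 : n • θ a ((n : K)⁻¹ * c) = 0 := h1
  rwa [← map_zsmul, zsmul_eq_mul, mul_inv_cancel_left₀ hn'] at h2

/-- A crossed homomorphism on the image of a free group is determined by its values on the basis
through Fox derivatives. -/
theorem crossed_eq_sum_foxD (hθ : ∀ a b c, θ (a * b) c = θ a c + θ b (τ a⁻¹ * c))
    {R : Type*} [Field R] {ι F : Type*} [Fintype ι] [DecidableEq ι] [Group F]
    (x : FreeGroupBasis ι F) (f : F →* G) (k : ℕ) (φ : GroupRing R G k →+* K)
    (hφ : ∀ a, φ (toGroupRing R G k a) = τ a) (w : F) (c : K) :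
    θ (f w) c = ∑ j, θ (f (x j)) (φ (foxD R x f k j w) * c) := by
  have h1 : ∀ c, θ 1 c = 0 := fun c => by simpa using hθ 1 1 c
  have hinv := fun j => derivation_inv (foxD_mul R x f k j)
  have hmul := fun j => foxD_mul R x f k j
  induction w using freeGroupBasis_induction x generalizing c with
  | one => simp [h1, fun j => derivation_one (foxD_mul R x f k j)]
  | basis j =>
    rw [Finset.sum_eq_single j]
    · simp [foxD_basis]
    · intro i _ hi
      simp [foxD_basis, hi]
    · simp
  | inv a ha =>
    have h2 := hθ (f a) (f a)⁻¹ (τ (f a) * c)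
    rw [mul_inv_cancel, h1, ← mul_assoc, ← map_mul, inv_mul_cancel, map_one, one_mul] at h2
    rw [map_inv, eq_neg_of_add_eq_zero_right h2.symm, ha, ← Finset.sum_neg_distrib]
    refine Finset.sum_congr rfl fun j _ => ?_
    simp [hinv, hφ, mul_assoc]
  | mul a b ha hb =>
    rw [map_mul, hθ, ha, hb, ← Finset.sum_add_distrib]
    refine Finset.sum_congr rfl fun j _ => ?_
    rw [hmul, map_add φ, map_mul φ, add_mul, map_add, MonoidHom.comp_apply, hφ, map_inv f,
      mul_assoc]

end Theta

section Homology

open CategoryTheory groupHomology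

/-- A criterion for `r_* = 0` on `H₁`. The maps `θ` are the crossed homomorphisms on `G`; the
universal one sends `c` to the class of the chain `a ⊗ c` modulo boundaries. -/
theorem groupHomology_map_eq_zero {R F S G : Type u} [CommRing R] [Group F] [Group S] [Group G]
    (i : F →* S) (r : S →* G) (A : Rep.{u} R G)
    (hs : Function.Surjective (groupHomology.map i (𝟙 (Rep.res i (Rep.res r A))) 1))
    (hz : ∀ (Q : Type u) [AddCommGroup Q] (θ : G → A →+ Q),
      (∀ a b c, θ (a * b) c = θ a c + θ b (A.ρ a⁻¹ c)) → ∀ z : F →₀ A,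
      (z.sum fun h a => A.ρ (r (i h))⁻¹ a) = (z.sum fun _ a => a) →
      (z.sum fun h a => θ (r (i h)) a) = 0) :
    groupHomology.map r (𝟙 (Rep.res r A)) 1 = 0 := by
  ext y
  obtain ⟨y, rfl⟩ := hs y
  induction y using H1_induction_on with
  | h z =>
    have e1 := ConcreteCategory.congr_hom (H1π_comp_map i (𝟙 (Rep.res i (Rep.res r A)))) z
    have e2 := ConcreteCategory.congr_hom (H1π_comp_map r (𝟙 (Rep.res r A)))
      (mapCycles₁ i (𝟙 (Rep.res i (Rep.res r A))) z)
    change groupHomology.map i (𝟙 (Rep.res i (Rep.res r A))) 1 (H1π _ z) = _ at e1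
    rw [e1]
    refine e2.trans ?_
    refine (H1π_eq_zero_iff _).2 ?_
    have h1 := (mem_cycles₁_iff _).1 z.2
    let θ : G → A →+ ((G →₀ A) ⧸ boundaries₁ A) := fun a =>
      (boundaries₁ A).mkQ.toAddMonoidHom.comp (Finsupp.singleAddHom a)
    have hθ : ∀ a b c, θ (a * b) c = θ a c + θ b (A.ρ a⁻¹ c) := by
      intro a b c
      have h1 : d₂₁ A (Finsupp.single (a, b) c) ∈ boundaries₁ A := ⟨_, rfl⟩
      rw [d₂₁_single] at h1
      have h2 := (Submodule.Quotient.mk_eq_zero _).2 h1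
      have h3 : θ b (A.ρ a⁻¹ c) - θ (a * b) c + θ a c = 0 := h2
      rw [sub_add_eq_add_sub, sub_eq_zero] at h3
      rw [add_comm, h3]
    have h2 := hz _ θ hθ z.1 (by simpa using h1)
    have h3 : Submodule.Quotient.mk (z.1.sum fun h a => Finsupp.single (r (i h)) a) =
        (0 : (G →₀ A) ⧸ boundaries₁ A) :=
      (map_finsuppSum (boundaries₁ A).mkQ z.1 _).trans h2
    convert (Submodule.Quotient.mk_eq_zero _).1 h3 using 1
    change chainsMap₁ r (𝟙 (Rep.res r A)) (chainsMap₁ i (𝟙 (Rep.res i (Rep.res r A))) z.1) = _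
    induction z.1 using Finsupp.induction_linear with
    | zero => simp
    | add a b ha hb =>
      rw [map_add, map_add, ha, hb, Finsupp.sum_add_index'] <;> simp
    | single h a => simp

theorem toFrac_toGroupRing (R : Type*) [Field R] (G : Type*) [Group G] (k : ℕ) (a : G) :
    toFrac R G k (toGroupRing R G k a) = toSkewField R G k a := rfl

instance charZero_skewField (G : Type*) [Group G] (k : ℕ) : CharZero (SkewField ℚ G k) := by
  have : CharZero (GroupRing ℚ G k) :=
    charZero_of_injective_algebraMap (algebraMap ℚ (GroupRing ℚ G k)).injective
  exact charZero_of_injective_ringHom (toFrac_injective ℚ G k)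

/-- Every cycle of a free group is homologous to a cycle `∑ x_j ⊗ a_j`. -/
theorem sum_crossed_eq_sum_basis {R : Type*} [Field R] {ι F G Q : Type*} [Fintype ι]
    [DecidableEq ι] [Group F] [Group G] [AddCommGroup Q] (x : FreeGroupBasis ι F) (f : F →* G)
    (k : ℕ) {θ : G → SkewField R G k →+ Q}
    (hθ : ∀ a b c, θ (a * b) c = θ a c + θ b (toSkewField R G k a⁻¹ * c))
    (z : F →₀ SkewField R G k)
    (hz : (z.sum fun w c => toSkewField R G k (f w)⁻¹ * c) = z.sum fun _ c => c) :
    ∃ a : ι → SkewField R G k, ∑ j, (toSkewField R G k (f (x j))⁻¹ - 1) * a j = 0 ∧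
      (z.sum fun w c => θ (f w) c) = ∑ j, θ (f (x j)) (a j) := by
  refine ⟨fun j => z.sum fun w c => toFrac R G k (foxD R x f k j w) * c, ?_, ?_⟩
  · have e2 : ∀ w c, ∑ j, (toSkewField R G k (f (x j))⁻¹ - 1) *
        (toFrac R G k (foxD R x f k j w) * c) = toSkewField R G k (f w)⁻¹ * c - c := by
      intro w c
      have h1 := congrArg (toFrac R G k) (sum_foxD R x f k w)
      simp only [map_sum, map_mul, map_sub, map_one, toFrac_toGroupRing] at h1
      simp only [← mul_assoc, ← Finset.sum_mul]
      rw [h1, sub_mul, one_mul]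
    simp only [Finsupp.sum, Finset.mul_sum]
    rw [Finset.sum_comm]
    simp only [e2, Finset.sum_sub_distrib]
    rw [sub_eq_zero]
    exact hz
  · have : ∀ w c, θ (f w) c = ∑ j, θ (f (x j)) (toFrac R G k (foxD R x f k j w) * c) :=
      fun w c => crossed_eq_sum_foxD hθ x f k (toFrac R G k) (toFrac_toGroupRing R G k) w c
    rw [Finsupp.sum, Finset.sum_congr rfl fun w _ => this w (z w), Finset.sum_comm]
    exact Finset.sum_congr rfl fun j _ => (map_sum _ _ _).symm

/-- A criterion for `r_* = 0` on `H₁(-; 𝕂(G_k))` in terms of the cycles `∑ x_j ⊗ a_j` of the free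
group. -/
theorem mapH1_coeffModule_eq_zero {R : Type} [Field R] {ι : Type*} [Fintype ι] [DecidableEq ι]
    {F S G : Type u} [Group F] [Group S] [Group G] (x : FreeGroupBasis ι F) (i : F →* S)
    (r : S →* G) (k : ℕ)
    (hs : Function.Surjective (mapH1 i (Rep.res r (coeffModule R G k))))
    (hz : ∀ (Q : Type u) [AddCommGroup Q] (θ : G → SkewField R G k →+ Q),
      (∀ a b c, θ (a * b) c = θ a c + θ b (toSkewField R G k a⁻¹ * c)) →
      ∀ a : ι → SkewField R G k,
        ∑ j, (toSkewField R G k (r (i (x j)))⁻¹ - 1) * a j = 0 →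
        ∑ j, θ (r (i (x j))) (a j) = 0) :
    mapH1 r (coeffModule R G k) = 0 := by
  refine groupHomology_map_eq_zero i r (coeffModule R G k) hs fun Q _ θ hθ z hzc => ?_
  obtain ⟨a, ha, e⟩ := sum_crossed_eq_sum_basis x (r.comp i) k hθ z hzc
  exact e.trans (hz Q θ hθ a ha)

/-- If all generators were trivial in `G_1`, then `F → G` would induce zero on `H₁` with
coefficients `𝕂(G_0)`, on which `G` acts trivially. -/
theorem IsAlgebraicSolution.exists_generator {F S G : Type u} [Group F] [Group S] [Group G]
    {g n : ℕ} (hn : 1 ≤ n) (x : FreeGroupBasis (Fin (2 * g)) F) {i : F →* S} {r : S →* G}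
    (hr : IsAlgebraicSolution ℚ n i r) : ∃ m, r (i (x m)) ∉ ratDerived G 1 := by
  by_contra! hcon
  refine hr.map_ne_zero 0 hn (mapH1_coeffModule_eq_zero x i r 0 (hr.map_surjective 0 hn) ?_)
  intro Q _ θ hθ a _
  refine Finset.sum_eq_zero fun j _ => crossed_eq_zero hθ 0 (fun b hb => ?_) (hcon j) _
  rw [← toFrac_toGroupRing, (toGroupRing_eq_one_iff ℚ 0).2 hb, map_one]

/-- If the vectors `d(w_a)` are independent over `ℚ G_k`, then some `w_a` is nontrivial in
`G_{k+1}`. -/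
theorem IsAlgebraicSolution.exists_notMem {F S G : Type u} [Group F] [Group S] [Group G]
    {g n : ℕ} {x : FreeGroupBasis (Fin (2 * g)) F} {i : F →* S} {r : S →* G}
    (hr : IsAlgebraicSolution ℚ n i r) {k : ℕ} (hk : k < n) {m : Fin (2 * g)}
    (hm : r (i (x m)) ∉ ratDerived G k) {w : Fin (2 * g - 1) → F}
    (hw : ∀ a, r (i (w a)) ∈ ratDerived G k) (h : FoxIndependent ℚ x (r.comp i) k m w) :
    ∃ a, r (i (w a)) ∉ ratDerived G (k + 1) := by
  -- Otherwise the classes of the `w_a`, which generate `H₁(F; 𝕂(G_k))`, vanish in `H₁(G; 𝕂(G_k))`.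
  by_contra! hcon
  refine hr.map_ne_zero k hk (mapH1_coeffModule_eq_zero x i r k (hr.map_surjective k hk) ?_)
  intro Q _ θ hθ a ha
  obtain ⟨c, hc⟩ := h.exists_eq_sum hm hw a ha
  have h0 : ∀ b, θ (r (i (w b))) (c b) = 0 := fun b =>
    crossed_eq_zero hθ k (fun b hb => by
      rw [← toFrac_toGroupRing, (toGroupRing_eq_one_iff ℚ k).2 hb, map_one]) (hcon b) _
  simp only [hc, map_sum]
  rw [Finset.sum_comm]
  refine Finset.sum_eq_zero fun b _ => ?_
  rw [← h0 b]
  exact (crossed_eq_sum_foxD hθ x (r.comp i) k (toFrac ℚ G k) (toFrac_toGroupRing ℚ G k)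
    (w b) (c b)).symm

end Homology

/-! ### Passing from a tuple to commutators of its members -/

theorem ratDerived_antitone (G : Type*) [Group G] : Antitone (ratDerived G) :=
  antitone_nat_of_succ_le (ratDerived_succ_le G)

section Commutators

variable (R : Type*) [Field R] {ι F G : Type*} [DecidableEq ι] [Group F] [Group G]
  (x : FreeGroupBasis ι F) (f : F →* G)

theorem foxD_commutator {k : ℕ} {a b : F} (ha : f a ∈ ratDerived G k) (hb : f b ∈ ratDerived G k)
    (j : ι) :
    foxD R x f (k + 1) j ⁅a, b⁆ =
      foxD R x f (k + 1) j a * (1 - toGroupRing R G (k + 1) (f b)⁻¹) +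
      foxD R x f (k + 1) j b * (toGroupRing R G (k + 1) (f a)⁻¹ - 1) := by
  rw [derivation_commutator_of_commute (foxD_mul R x f (k + 1) j)]
  · simp only [MonoidHom.comp_apply, map_inv f]
  · simp only [MonoidHom.comp_apply, map_mul f]
    exact toGroupRing_mul_comm R k ha hb

theorem foxD_commutator_conj {k : ℕ} {a : F} (ha : f a ∈ ratDerived G k) (y : F) (j : ι) :
    foxD R x f (k + 1) j ⁅a, y⁻¹ * a * y⁆ =
      foxD R x f (k + 1) j a * (1 - toGroupRing R G (k + 1) ((f y)⁻¹ * (f a)⁻¹ * f y) +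
        toGroupRing R G (k + 1) (f y * (f a)⁻¹) - toGroupRing R G (k + 1) (f y)) +
      foxD R x f (k + 1) j y * ((toGroupRing R G (k + 1) (f a)⁻¹ - 1) *
        toGroupRing R G (k + 1) (f y) * (toGroupRing R G (k + 1) (f a)⁻¹ - 1)) := by
  rw [derivation_commutator_conj (foxD_mul R x f (k + 1) j)]
  · simp only [MonoidHom.comp_apply, map_inv f, map_mul f]
  · simp only [MonoidHom.comp_apply, map_mul f, map_inv f]
    refine toGroupRing_mul_comm R k ha ?_
    simpa using (normal_ratDerived G k).conj_mem _ ha (f y)⁻¹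

theorem toGroupRing_sub_one_ne_zero {k : ℕ} {a : G} (ha : a ∉ ratDerived G k) :
    toGroupRing R G k a - 1 ≠ 0 := by
  rwa [sub_ne_zero, Ne, toGroupRing_eq_one_iff]

theorem toGroupRing_conj_coefficient_ne_zero {k : ℕ} {a y : G} (ha : a ∉ ratDerived G k)
    (hy : y ∉ ratDerived G k) :
    1 - toGroupRing R G k (y⁻¹ * a⁻¹ * y) + toGroupRing R G k (y * a⁻¹) - toGroupRing R G k y ≠ 0 :=
  conj_coefficient_ne_zero R (a := (a : RatQuot G k)) (y := (y : RatQuot G k))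
    (mt (QuotientGroup.eq_one_iff a).1 ha) (mt (QuotientGroup.eq_one_iff y).1 hy)

theorem toGroupRing_conj_coefficient_ne_zero' {k : ℕ} {a y : G} (ha : a ∉ ratDerived G k)
    (hy : y ∈ ratDerived G k) (hy' : y ∉ ratDerived G (k + 1)) :
    1 - toGroupRing R G (k + 1) (a * (y⁻¹ * a⁻¹ * y) * a⁻¹) + toGroupRing R G (k + 1) y *
      (toGroupRing R G (k + 1) a⁻¹ -
        toGroupRing R G (k + 1) ((y⁻¹ * a * y) * a * (y⁻¹ * a⁻¹ * y) * a⁻¹)) ≠ 0 := by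
  refine conj_coefficient_ne_zero' R (a := (a : RatQuot G (k + 1))) (y := (y : RatQuot G (k + 1)))
    (fun h => ha (ratDerived_succ_le G k ((QuotientGroup.eq_one_iff a).1 h)))
    (mt (QuotientGroup.eq_one_iff y).1 hy') fun h => ha ?_
  have h1 := ratDerived_succ_le G k (QuotientGroup.eq.1 h)
  simpa using mul_mem hy h1

end Commutators

section Step

variable {R : Type*} [Field R] {g : ℕ} {F G : Type*} [Group F] [Group G]
  {x : FreeGroupBasis (Fin (2 * g)) F} {f : F →* G} {m : Fin (2 * g)}

/-- The tuple `{[x_m, x_j] : j ≠ m}` is independent over `R G_1`: as `G_1` is abelian, its vectors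
are the multiples of the standard basis by `x_m⁻¹ - 1`. -/
theorem foxIndependent_one (hm : f (x m) ∉ ratDerived G 1)
    (e : Fin (2 * g - 1) ≃ {j : Fin (2 * g) // j ≠ m}) :
    FoxIndependent R x f 1 m fun a => ⁅x m, x (e a)⁆ := by
  rw [foxIndependent_iff]
  intro c hc
  ext1 a
  have h := hc (e a) (e a).2
  have htop : ∀ y : G, y ∈ ratDerived G 0 := fun _ => trivial
  rw [Finset.sum_eq_single a] at h
  · rw [foxD_commutator R x f (htop _) (htop _), foxD_basis, foxD_basis, if_neg (e a).2, if_pos rfl,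
      zero_mul, zero_add, one_mul] at h
    exact (mul_eq_zero.1 h).resolve_left
      (toGroupRing_sub_one_ne_zero R (mt inv_mem_iff.1 hm))
  · intro b _ hb
    have : (e a : Fin (2 * g)) ≠ e b := fun h => hb (e.injective (Subtype.ext h)).symm
    rw [foxD_commutator R x f (htop _) (htop _), foxD_basis, foxD_basis, if_neg (e a).2,
      if_neg this, zero_mul, zero_mul, zero_add, zero_mul]
  · simp

/-- The commutators of the members of an independent tuple with a member `w_b` that is nontrivial in
`G_{k+1}`, together with `[w_b, w_b^{x_m}]`, are independent over `R G_{k+1}`. -/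
theorem FoxIndependent.commutators {k : ℕ} {w : Fin (2 * g - 1) → F}
    (h : FoxIndependent R x f k m w) (hw : ∀ a, f (w a) ∈ ratDerived G k) {b : Fin (2 * g - 1)}
    (hb : f (w b) ∉ ratDerived G (k + 1)) (hm : f (x m) ∉ ratDerived G (k + 1)) :
    FoxIndependent R x f (k + 1) m
      fun a => if a = b then ⁅w b, (x m)⁻¹ * w b * x m⁆ else ⁅w a, w b⁆ := by
  have h' := foxIndependent_iff.1 h.succ
  rw [foxIndependent_iff]
  intro c hc
  let τ := toGroupRing R G (k + 1)
  let p := 1 - τ ((f (x m))⁻¹ * (f (w b))⁻¹ * f (x m)) + τ (f (x m) * (f (w b))⁻¹) - τ (f (x m))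
  have hp : p ≠ 0 := toGroupRing_conj_coefficient_ne_zero R hb hm
  have hs : 1 - τ (f (w b))⁻¹ ≠ 0 := by
    rw [← neg_sub, neg_ne_zero]
    exact toGroupRing_sub_one_ne_zero R (mt inv_mem_iff.1 hb)
  -- The relation for the commutators is a relation for `w` with triangularly changed coefficients.
  let d : Fin (2 * g - 1) → GroupRing R G (k + 1) := fun a =>
    if a = b then p * c b + ∑ a ∈ Finset.univ.erase b, (τ (f (w a))⁻¹ - 1) * c a
    else (1 - τ (f (w b))⁻¹) * c a
  have hd : d = 0 := by
    refine h' d fun j hj => ?_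
    rw [← hc j hj, ← Finset.add_sum_erase _ _ (Finset.mem_univ b),
      ← Finset.add_sum_erase (Finset.univ) _ (Finset.mem_univ b)]
    simp only [d, if_pos]
    rw [foxD_commutator_conj R x f (hw b), foxD_basis, if_neg hj, zero_mul, add_zero, mul_add,
      add_assoc, ← mul_assoc, Finset.mul_sum, ← Finset.sum_add_distrib]
    congr 1
    refine Finset.sum_congr rfl fun a ha => ?_
    rw [if_neg (Finset.ne_of_mem_erase ha), if_neg (Finset.ne_of_mem_erase ha),
      foxD_commutator R x f (hw a) (hw b), add_mul, mul_assoc, mul_assoc]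
    exact add_comm _ _
  have hne : ∀ a, a ≠ b → c a = 0 := by
    intro a ha
    have := congrFun hd a
    simp only [d, if_neg ha, Pi.zero_apply] at this
    exact (mul_eq_zero.1 this).resolve_left hs
  ext1 a
  by_cases ha : a = b
  · subst ha
    have := congrFun hd a
    simp only [d, if_pos, Pi.zero_apply] at this
    rw [Finset.sum_eq_zero fun i hi => by rw [hne i (Finset.ne_of_mem_erase hi), mul_zero],
      add_zero] at this
    exact (mul_eq_zero.1 this).resolve_left hp
  · exact hne a ha

theorem FoxIndependent.comp_perm {k : ℕ} {w : Fin (2 * g - 1) → F}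
    (h : FoxIndependent R x f k m w) (σ : Equiv.Perm (Fin (2 * g - 1))) :
    FoxIndependent R x f k m (w ∘ σ) :=
  LinearIndependent.comp h σ σ.injective

end Step

/-- The hypothesis `hb` on the numbers of the members of a tuple fails only for `g = 1` and
`m = 0`. -/
theorem IsAlgebraicSolution.exists_foxIndependent {F S G : Type u} [Group F] [Group S] [Group G]
    {g n : ℕ} {x : FreeGroupBasis (Fin (2 * g)) F} {i : F →* S} {r : S →* G}
    (hr : IsAlgebraicSolution ℚ n i r) {m : Fin (2 * g)} (hm : r (i (x m)) ∉ ratDerived G 1)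
    (hb : ∃ b : Fin (2 * g - 1), (m : ℕ) ≠ (b : ℕ)) {k : ℕ} (hk : 1 ≤ k) (hkn : k ≤ n) :
    ∃ w : Fin (2 * g - 1) → F, (∀ a, r (i (w a)) ∈ ratDerived G k) ∧ Set.range w ∈ tuples x k ∧
      ∀ (R : Type) [Field R], FoxIndependent R x (r.comp i) k m w := by
  induction k, hk using Nat.le_induction with
  | base =>
    obtain ⟨e⟩ : Nonempty (Fin (2 * g - 1) ≃ {j : Fin (2 * g) // j ≠ m}) :=
      Fintype.card_eq.1 (by simp)
    refine ⟨fun a => ⁅x m, x (e a)⁆, fun a => ?_, ⟨m, ?_⟩, fun R _ => foxIndependent_one hm e⟩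
    · rw [map_commutatorElement, map_commutatorElement]
      exact commutator_mem_ratDerived_succ 0 trivial trivial
    · ext c
      constructor
      · rintro ⟨a, rfl⟩
        exact ⟨e a, (e a).2, rfl⟩
      · rintro ⟨j, hj, rfl⟩
        exact ⟨e.symm ⟨j, hj⟩, by simp⟩
  | succ k hk ih =>
    obtain ⟨w, hw, hwt, hwi⟩ := ih (by omega)
    have hm' : ∀ l, 1 ≤ l → r (i (x m)) ∉ ratDerived G l := fun l hl h =>
      hm (ratDerived_antitone G hl h)
    obtain ⟨a, ha⟩ := hr.exists_notMem (Nat.lt_of_succ_le hkn) (hm' k hk) hw (hwi ℚ)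
    obtain ⟨b, hb⟩ := hb
    -- The tuple is renumbered so that its member nontrivial in `G_{k+1}` gets a number other than
    -- that of `x_m`, and may be conjugated by `x_m`.
    let w' := w ∘ Equiv.swap b a
    have hw' : ∀ c, r (i (w' c)) ∈ ratDerived G k := fun c => hw _
    have hb' : r (i (w' b)) ∉ ratDerived G (k + 1) := by
      simpa [w'] using ha
    have hind : ∀ (R : Type) [Field R], FoxIndependent R x (r.comp i) (k + 1) m
        fun c => if c = b then ⁅w' b, (x m)⁻¹ * w' b * x m⁆ else ⁅w' c, w' b⁆ := fun R _ =>
      ((hwi R).comp_perm _).commutators hw' hb' (hm' _ (by omega))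
    refine ⟨_, fun c => ?_, ?_, hind⟩
    · split_ifs with hc
      · rw [map_commutatorElement, map_commutatorElement]
        refine commutator_mem_ratDerived_succ k (hw' b) ?_
        simpa using (normal_ratDerived G k).conj_mem _ (hw' b) (r (i (x m)))⁻¹
      · rw [map_commutatorElement, map_commutatorElement]
        exact commutator_mem_ratDerived_succ k (hw' c) (hw' b)
    · obtain ⟨l, rfl⟩ := Nat.exists_eq_add_of_le' hk
      refine ⟨w', _, (hwi ℚ).injective.comp (Equiv.injective _), ?_, (hind ℚ).injective, rfl,
        fun c => ?_⟩
      · rwa [EquivLike.range_comp w (Equiv.swap b a)]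
      · by_cases hc : c = b
        · subst hc
          exact Or.inl ⟨m, hb, if_pos rfl⟩
        · exact Or.inr ⟨b, Ne.symm hc, if_neg hc⟩

/-! ### Rank two -/

/-- The sequence `w_0 = [a, b]`, `w_{n+1} = [w_n, w_n^b]` of iterated commutators. The term `w_n`
lies in the `(n+1)`-st derived subgroup. -/
def iteratedCommutator {F : Type*} [Group F] (a b : F) : ℕ → F
  | 0 => ⁅a, b⁆
  | n + 1 => ⁅iteratedCommutator a b n, b⁻¹ * iteratedCommutator a b n * b⁆

section RankTwo

variable {F G : Type*} [Group F] [Group G] (x : FreeGroupBasis (Fin 2) F) (f : F →* G)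

theorem iteratedCommutator_mem (n : ℕ) :
    f (iteratedCommutator (x 0) (x 1) n) ∈ ratDerived G (n + 1) := by
  induction n with
  | zero =>
    rw [iteratedCommutator, map_commutatorElement]
    exact commutator_mem_ratDerived_succ 0 trivial trivial
  | succ n ih =>
    rw [iteratedCommutator, map_commutatorElement]
    refine commutator_mem_ratDerived_succ _ ih ?_
    simpa using (normal_ratDerived G (n + 1)).conj_mem _ ih (f (x 1))⁻¹

/-- The fundamental formula of Fox calculus for two generators. -/
theorem foxD_add_foxD (R : Type*) [Field R] (k : ℕ) (w : F) :
    (toGroupRing R G k (f (x 0))⁻¹ - 1) * foxD R x f k 0 w +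
      (toGroupRing R G k (f (x 1))⁻¹ - 1) * foxD R x f k 1 w =
      toGroupRing R G k (f w)⁻¹ - 1 := by
  rw [← sum_foxD R x f k w, Fin.sum_univ_two]

variable {x f}

/-- At the first stage `G_{k+1}` of the series where `x_1` is nontrivial, the derivative `d_0` of
`[w, w^{x_1}]` is nonzero if `w` is already nontrivial in `G_k`. In contrast to
`foxD_commutator_conj`, the elements `w` and `w^{x_1}` need not commute in `G_{k+1}`. -/
theorem foxD_zero_commutator_conj_ne_zero (R : Type*) [Field R]
    {k : ℕ} {w : F} (hw : f w ∉ ratDerived G k) (h1 : f (x 1) ∈ ratDerived G k)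
    (h1' : f (x 1) ∉ ratDerived G (k + 1)) :
    foxD R x f (k + 1) 0 ⁅w, (x 1)⁻¹ * w * x 1⁆ ≠ 0 := by
  have e := foxD_add_foxD x f R k w
  rw [(toGroupRing_eq_one_iff R k).2 (inv_mem h1), sub_self, zero_mul, add_zero] at e
  have hw0 : foxD R x f k 0 w ≠ 0 := by
    intro h
    rw [h, mul_zero] at e
    exact toGroupRing_sub_one_ne_zero R (mt inv_mem_iff.1 hw) e.symm
  rw [derivation_commutator (foxD_mul R x f (k + 1) 0), derivation_conj (foxD_mul R x f (k + 1) 0),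
    foxD_basis, if_neg (by decide), zero_mul, add_zero,
    mul_assoc (foxD R x f (k + 1) 0 w) ((toGroupRing R G (k + 1)).comp f (x 1)), ← mul_add]
  refine mul_ne_zero (foxD_ne_zero_succ x f k 0 w hw0) ?_
  have := toGroupRing_conj_coefficient_ne_zero' R hw h1 h1'
  simp only [MonoidHom.comp_apply, map_mul f, map_inv f, mul_inv_rev, inv_inv]
  simpa only [mul_assoc] using this

/-- In rank two, `d_1` of the `n`-th iterated commutator is nonzero over `R G_{n+1}`, provided that
the earlier iterated commutators with this property are nontrivial one stage further. The second
assertion, on the case where `x_1` becomes nontrivial exactly in `G_{n+2}`, is what the induction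
needs to compute with `d_0` from then on. -/
theorem foxD_iteratedCommutator_ne_zero (h0 : f (x 0) ∉ ratDerived G 1) (n : ℕ)
    (hn : ∀ l < n, (∀ (R : Type) [Field R],
        foxD R x f (l + 1) 1 (iteratedCommutator (x 0) (x 1) l) ≠ 0) →
      f (iteratedCommutator (x 0) (x 1) l) ∉ ratDerived G (l + 2)) :
    (∀ (R : Type) [Field R], foxD R x f (n + 1) 1 (iteratedCommutator (x 0) (x 1) n) ≠ 0) ∧
      (f (x 1) ∈ ratDerived G (n + 1) → f (x 1) ∉ ratDerived G (n + 2) →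
        ∀ (R : Type) [Field R], foxD R x f (n + 2) 0 (iteratedCommutator (x 0) (x 1) n) ≠ 0) := by
  have h0' : ∀ (R : Type) [Field R] k, toGroupRing R G (k + 1) (f (x 0))⁻¹ - 1 ≠ 0 :=
    fun R _ k => toGroupRing_sub_one_ne_zero R (mt inv_mem_iff.1 fun h =>
      h0 (ratDerived_antitone G (Nat.le_add_left 1 k) h))
  induction n with
  | zero =>
    refine ⟨fun R _ => ?_, fun _ h1' R _ => ?_⟩
    · rw [iteratedCommutator, foxD_commutator R x f (k := 0) trivial trivial, foxD_basis,
        foxD_basis, if_neg (by decide), if_pos rfl]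
      simp only [zero_mul, zero_add, one_mul]
      exact h0' R 0
    · rw [iteratedCommutator, derivation_commutator (foxD_mul R x f _ 0), foxD_basis,
        foxD_basis, if_pos rfl, if_neg (by decide), zero_mul, add_zero, one_mul,
        ← neg_sub, neg_ne_zero]
      refine toGroupRing_sub_one_ne_zero R fun h => h1' ?_
      have := (normal_ratDerived G 2).conj_mem _ h (f (x 0))⁻¹
      simpa [mul_assoc] using this
  | succ n ih =>
    obtain ⟨hT, hU⟩ := ih fun l hl => hn l (by omega)
    set w := iteratedCommutator (x 0) (x 1) n with hw
    have hwn : f w ∉ ratDerived G (n + 2) := hn n (by omega) hT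
    have hwm : f w ∈ ratDerived G (n + 1) := iteratedCommutator_mem x f n
    rw [show iteratedCommutator (x 0) (x 1) (n + 1) = ⁅w, (x 1)⁻¹ * w * x 1⁆ from rfl]
    refine ⟨fun R _ => ?_, fun h1 h1' R _ =>
      foxD_zero_commutator_conj_ne_zero R hwn h1 h1'⟩
    by_cases h1 : f (x 1) ∈ ratDerived G (n + 2)
    -- The coefficient of `d_1(w)` vanishes and that of `d_1(x_1) = 1` is `(w⁻¹ - 1)²`.
    · have e1 : toGroupRing R G (n + 2) (f (x 1)) = 1 := (toGroupRing_eq_one_iff R _).2 h1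
      have e2 : toGroupRing R G (n + 2) (f (x 1))⁻¹ = 1 :=
        (toGroupRing_eq_one_iff R _).2 (inv_mem h1)
      rw [foxD_commutator_conj R x f hwm, foxD_basis, if_pos rfl]
      simp only [map_mul, e1, e2, one_mul, mul_one, sub_add_cancel, sub_self, mul_zero, zero_add]
      exact mul_ne_zero (toGroupRing_sub_one_ne_zero R (mt inv_mem_iff.1 hwn))
        (toGroupRing_sub_one_ne_zero R (mt inv_mem_iff.1 hwn))
    -- Otherwise `d_0` is nonzero, and `d_1` is related to it by the fundamental formula.
    · have hd0 : foxD R x f (n + 2) 0 w ≠ 0 := by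
        by_cases h1' : f (x 1) ∈ ratDerived G (n + 1)
        · exact hU h1' h1 R
        · refine foxD_ne_zero_succ x f (n + 1) 0 w fun h => ?_
          have e := foxD_add_foxD x f R (n + 1) w
          rw [h, mul_zero, zero_add, (toGroupRing_eq_one_iff R _).2 (inv_mem hwm), sub_self] at e
          exact mul_ne_zero (toGroupRing_sub_one_ne_zero R (mt inv_mem_iff.1 h1')) (hT R) e
      have hz0 : foxD R x f (n + 2) 0 ⁅w, (x 1)⁻¹ * w * x 1⁆ ≠ 0 := by
        rw [foxD_commutator_conj R x f hwm, foxD_basis, if_neg (by decide), zero_mul, add_zero]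
        exact mul_ne_zero hd0 (toGroupRing_conj_coefficient_ne_zero R hwn h1)
      intro h
      have e := foxD_add_foxD x f R (n + 2) ⁅w, (x 1)⁻¹ * w * x 1⁆
      have hzm : f ⁅w, (x 1)⁻¹ * w * x 1⁆ ∈ ratDerived G (n + 2) :=
        iteratedCommutator_mem x f (n + 1)
      rw [h, mul_zero, add_zero, (toGroupRing_eq_one_iff R _).2 (inv_mem hzm), sub_self] at e
      exact mul_ne_zero (h0' R _) hz0 e

end RankTwo

theorem range_iteratedCommutator_mem_tuples {F : Type*} [Group F]
    (x : FreeGroupBasis (Fin (2 * 1)) F) (n : ℕ) :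
    Set.range (fun _ : Fin (2 * 1 - 1) => iteratedCommutator (x 0) (x 1) n) ∈ tuples x (n + 1) := by
  induction n with
  | zero =>
    refine ⟨0, ?_⟩
    ext c
    constructor
    · rintro ⟨_, rfl⟩
      exact ⟨1, by decide, rfl⟩
    · rintro ⟨j, hj, rfl⟩
      obtain rfl : j = 1 := (by decide : ∀ j : Fin (2 * 1), j ≠ 0 → j = 1) j hj
      exact ⟨0, rfl⟩
  | succ n ih =>
    refine ⟨_, _, fun a b _ => Subsingleton.elim (α := Fin 1) a b, ih,
      fun a b _ => Subsingleton.elim (α := Fin 1) a b, rfl, fun a => Or.inl ⟨1, ?_, rfl⟩⟩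
    obtain rfl : a = 0 := Subsingleton.elim (α := Fin 1) a 0
    decide

theorem foxIndependent_zero_iff {R : Type*} [Field R] {F G : Type*} [Group F] [Group G]
    {x : FreeGroupBasis (Fin (2 * 1)) F} {f : F →* G} {k : ℕ} {w : F} :
    FoxIndependent R x f k 0 (fun _ => w) ↔ foxD R x f k 1 w ≠ 0 := by
  rw [foxIndependent_iff]
  constructor
  · intro h hw
    have := h 1 fun j hj => by
      obtain rfl : j = 1 := (by decide : ∀ j : Fin (2 * 1), j ≠ 0 → j = 1) j hj
      simp [hw]
    exact one_ne_zero (congrFun this (0 : Fin 1))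
  · intro h c hc
    have h1 : foxD R x f k 1 w * c (0 : Fin 1) = 0 := by
      rw [← hc 1 (by decide)]
      exact (Fin.sum_univ_one (fun a : Fin 1 => foxD R x f k 1 w * c a)).symm
    ext1 a
    obtain rfl : a = (0 : Fin 1) := Subsingleton.elim (α := Fin 1) a 0
    exact (mul_eq_zero.1 h1).resolve_left h

end AlgSol

open AlgSol in
theorem lemma5p11 {F S G : Type u} [Group F] [Group S] [Group G] (g n : ℕ) (hn : 1 ≤ n)
    (x : FreeGroupBasis (Fin (2 * g)) F) (i : F →* S) (r : S →* G)
    (hr : AlgSol.IsAlgebraicSolution ℚ n i r) :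
    (∃ m, r (i (x m)) ∉ AlgSol.ratDerived G 1) ∧
    ∀ m, r (i (x m)) ∉ AlgSol.ratDerived G 1 →
      ∃ w : Fin (2 * g - 1) → F, Function.Injective w ∧ Set.range w ∈ AlgSol.tuples x n ∧
        AlgSol.FoxIndependent ℚ x (r.comp i) n m w ∧
        ∀ (p : ℕ) [Fact p.Prime], AlgSol.FoxIndependent (ZMod p) x (r.comp i) n m w := by
  refine ⟨hr.exists_generator hn x, fun m hm => ?_⟩
  suffices h : ∃ w : Fin (2 * g - 1) → F, Set.range w ∈ tuples x n ∧
      ∀ (R : Type) [Field R], FoxIndependent R x (r.comp i) n m w by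
    obtain ⟨w, hw, h⟩ := h
    exact ⟨w, (h ℚ).injective, hw, h ℚ, fun p _ => h (ZMod p)⟩
  by_cases hb : ∃ b : Fin (2 * g - 1), (m : ℕ) ≠ (b : ℕ)
  · obtain ⟨w, -, hw, h⟩ := hr.exists_foxIndependent hm hb hn le_rfl
    exact ⟨w, hw, h⟩
  push Not at hb
  obtain rfl : g = 1 := by
    have := m.2
    by_contra hg
    -- Two different members of the tuple cannot both have the number `m`.
    have h1 := hb ⟨0, by omega⟩
    have h2 := hb ⟨1, by omega⟩
    simp_all
  obtain rfl : m = 0 := Fin.ext (hb (0 : Fin 1))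
  obtain ⟨n, rfl⟩ := Nat.exists_eq_add_of_le' hn
  refine ⟨_, range_iteratedCommutator_mem_tuples x n, fun R _ => foxIndependent_zero_iff.2 ?_⟩
  refine (foxD_iteratedCommutator_ne_zero (x := x) (f := r.comp i) hm n fun l hl h => ?_).1 R
  obtain ⟨_, ha⟩ := hr.exists_notMem (k := l + 1) (by omega)
    (fun h => hm (ratDerived_antitone G (by omega) h))
    (fun _ => iteratedCommutator_mem (x : FreeGroupBasis (Fin 2) F) (r.comp i) l)
    (foxIndependent_zero_iff.2 (h ℚ))
  exact ha
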